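/- Let $\Gamma$ be a finite two-player extensive-form game with perfect recall, possibly with chance moves (each of positive probability), with at least one decision node; let $N$ be the number of nodes of its tree. Let $Z$ be the set of terminal nodes, $u_i(z)$ the payoff of player $i$ at $z$, and $p(z)$ the product of the probabilities of the chance moves on the path to $z$. Let $\Sigma_i$ be the set of pairs $(I,a)$ (sequences) of an information set $I$ of player $i$ and an action $a$ at $I$, $\sigma_i(z)$ the last sequence of player $i$ on the path to $z$, and $\Pi_i$ the set of pure reduced-normal-form strategies of player $i$, with subsets $\Pi_i(I)$, $\Pi_i(\sigma)$, $\Pi_i(z)$ of those that can lead to $I$; that can lead to $I$ and prescribe $a$ there, where $\sigma=(I,a)$; and that can lead to $z$. A distribution $\mu$ over $\Pi_1\times\Pi_2$ is an EFCE (extensive-form correlated equilibrium) if following all recommendations is a best response for each player when a device samples $(\pi_1,\pi_2)\sim\mu$ and privately reveals to each player the recommended action at an information set when it is reached, and reveals nothing more to a player once that player has deviated. For $\hat\sigma=(\hat I,\hat a)\in\Sigma_i$ and a distribution $\hat\mu$ over $\Pi_i(\hat I)$, the $(\hat\sigma,\hat\mu)$-trigger agent of player $i$ follows all recommendations, except that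 if $\hat a$ is recommended at $\hat I$, it plays from $\hat I$ on according to a plan sampled from $\hat\mu$. The correlation plan of $\mu$ is the vector $\xi=(\xi_1,\xi_2)$, where for $\sigma\in\Sigma_i$, $z\in Z$, $$\xi_i(\sigma;z)=\Pr_{\pi\sim\mu}\bigl[\pi_i\in\Pi_i(\sigma),\ \pi_{-i}\in\Pi_{-i}(z)\bigr].$$ Let $\mathcal X$ be the set of all correlation plans; $\xi\in\mathcal X$ is called an EFCE if it is the correlation plan of an EFCE. For $\hat\sigma=(\hat I,\hat a)\in\Sigma_i$ let $Y_{i,\hat\sigma}\subset\mathbb R^{\Sigma_i}$ be the set of all $y\ge 0$ such that $\sum_a y(I,a)$ equals, for every information set $I$ of player $i$, the value of $y$ at the last sequence of player $i$ before $I$ (or $1$ if there is none), and $\sum_a y(\hat I,a)=1$. For $\xi$ and $y\in Y_{i,\hat\sigma}$ the trigger value is $$v_{i,\hat\sigma}(\xi,y)=g_{i,\hat\sigma}(\xi,y)-b_{i,\hat\sigma}(\xi),$$ $$g_{i,\hat\sigma}(\xi,y)=\sum_{z\text{ through }\hat I}p(z)u_i(z)\,\xi_i(\hat\sigma;z)\,y(\sigma_i(z)),\qquad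 b_{i,\hat\sigma}(\xi)=\sum_{z\text{ through }\hat\sigma}p(z)u_i(z)\,\xi_i(\sigma_i(z);z),$$ where "through $\hat I$" means that the path to $z$ contains a node of $\hat I$ (with any action there), and "through $\hat\sigma$" that it contains the action $\hat a$ taken at $\hat I$. Let $v^*(\xi)$ be the supremum of $v_{i,\hat\sigma}(\xi,y)$ over $i\in\{1,2\}$, $\hat\sigma\in\Sigma_i$, $y\in Y_{i,\hat\sigma}$. Let $\mathcal Y$ be the set of all $w=(\lambda_{i,\hat\sigma},z_{i,\hat\sigma})_{i,\hat\sigma}$ with $\lambda_{i,\hat\sigma}\in[0,1]$, $\sum_{i,\hat\sigma}\lambda_{i,\hat\sigma}=1$ and $z_{i,\hat\sigma}\in\lambda_{i,\hat\sigma}Y_{i,\hat\sigma}$, and let $$f(\xi,w)=\sum_i\sum_{\hat\sigma\in\Sigma_i}\bigl(g_{i,\hat\sigma}(\xi,z_{i,\hat\sigma})-\lambda_{i,\hat\sigma}b_{i,\hat\sigma}(\xi)\bigr).$$ Then: 1. $\mathcal X$ and $\mathcal Y$ are polytopes, each in a coordinate space of dimension at most $N^2$. Each $Y_{i,\hat\sigma}$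 is a polytope, and equals the set of the vectors $y(\sigma)=\hat\mu(\Pi_i(\sigma))$, where $\hat\mu$ ranges over the distributions over $\Pi_i(\hat I)$. 2. If $\xi$ is the correlation plan of $\mu$ and $y$ is the vector of $\hat\mu$, then $v_{i,\hat\sigma}(\xi,y)$ is the expected utility of the $(\hat\sigma,\hat\mu)$-trigger agent minus the expected utility of player $i$ when following all recommendations. The function $v_{i,\hat\sigma}$ is biaffine: $g_{i,\hat\sigma}(\xi,y)=\xi_i^\top A_{i,\hat\sigma}y$ for a matrix $A_{i,\hat\sigma}$, and $b_{i,\hat\sigma}$ is linear in $\xi_i$. 3. The supremum defining $v^*(\xi)$ is attained, $v^*(\xi)=\max_{w\in\mathcal Y}f(\xi,w)$, and $f$ is bilinear, $f(\xi,w)=\xi^\top Mw$ for a matrix $M$. 4. A distribution $\mu$ is an EFCE if and only if no trigger agent of any player $i$ has a larger expected utility than player $i$ has when following all recommendations, and if and only if $v^*(\xi)\le 0$ for its correlation plan $\xi$. A correlation plan $\xi\in\mathcal X$ is an EFCE if and only if $v^*(\xi)\le0$. 5. An EFCE exists, and $\min_{\xi\in\mathcal X}\max_{w\in\mathcal Y}f(\xi,w)=\min_{\xi\in\mathcal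 X}v^*(\xi)=0$. For $\xi\in\mathcal X$ the following are equivalent: $\xi$ is an EFCE; $\xi$ minimizes $v^*$ over $\mathcal X$; there is $w\in\mathcal Y$ such that $(\xi,w)$ is a saddle point of $f$ on $\mathcal X\times\mathcal Y$ (minimizing in $\xi$, maximizing in $w$). -/

import Mathlib

open scoped BigOperators Pointwise Matrix

universe u v

/-- A finite rooted game tree for two players (indexed by `Fin 2`). `Info i` is the set of
information sets of player `i`, and `Act i I` the set of actions at the information set `I`.
A node is terminal (labelled by the payoffs), a chance node (labelled by the probabilities of its
`n` outgoing edges), or a decision node in the information set `I` of player `i`, whose outgoing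
edges are the actions at `I`. -/
inductive GameTree (Info : Fin 2 → Type u) (Act : ∀ i, Info i → Type v) : Type (max u v) where
  | leaf (payoff : Fin 2 → ℝ) : GameTree Info Act
  | chance (n : ℕ) (p : Fin n → ℝ) (child : Fin n → GameTree Info Act) : GameTree Info Act
  | decision (i : Fin 2) (I : Info i) (child : Act i I → GameTree Info Act) : GameTree Info Act

namespace GameTree

variable {Info : Fin 2 → Type u} {Act : ∀ i, Info i → Type v}

/-- Prepend the move `a` of player `i` at `I` to the pair of own-move lists `h`. -/
def push (i : Fin 2) (I : Info i) (a : Act i I) (h : ∀ j, List (Σ I : Info j, Act j I)) :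
    ∀ j, List (Σ I : Info j, Act j I) :=
  Function.update h i (⟨I, a⟩ :: h i)

/-- `At T h S`: some node of `T` has `S` as the subtree below it, and on the path from the root to
this node each player `j` makes exactly the moves `h j`, in this order (root first). -/
inductive At : GameTree Info Act → (∀ j, List (Σ I : Info j, Act j I)) → GameTree Info Act → Prop
  | here (T : GameTree Info Act) : At T (fun _ => []) T
  | chance {n : ℕ} {p : Fin n → ℝ} {child : Fin n → GameTree Info Act} (k : Fin n)
      {h : ∀ j, List (Σ I : Info j, Act j I)} {S : GameTree Info Act}
      (H : At (child k) h S) : At (.chance n p child) h S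
  | decision {i : Fin 2} {I : Info i} {child : Act i I → GameTree Info Act} (a : Act i I)
      {h : ∀ j, List (Σ I : Info j, Act j I)} {S : GameTree Info Act}
      (H : At (child a) h S) : At (.decision i I child) (push i I a h) S

/-- The number of nodes of the tree. -/
def numNodes [∀ i I, Fintype (Act i I)] : GameTree Info Act → ℕ
  | leaf _ => 1
  | chance _ _ child => 1 + ∑ k, numNodes (child k)
  | decision _ _ child => 1 + ∑ a, numNodes (child a)

/-- The terminal nodes of a tree, each given by its path from the root. -/
def Terminal : GameTree Info Act → Type v
  | leaf _ => PUnit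
  | chance n _ child => Σ k : Fin n, Terminal (child k)
  | decision i I child => Σ a : Act i I, Terminal (child a)

theorem finite_terminal [∀ i I, Fintype (Act i I)] (T : GameTree Info Act) :
    Finite T.Terminal := by
  induction T with
  | leaf _ => exact inferInstanceAs (Finite PUnit)
  | chance n p child ih => exact inferInstanceAs (Finite (Σ k : Fin n, Terminal (child k)))
  | decision i I child ih => exact inferInstanceAs (Finite (Σ a : Act i I, Terminal (child a)))

noncomputable instance [∀ i I, Fintype (Act i I)] (T : GameTree Info Act) : Fintype T.Terminal :=
  haveI := finite_terminal T
  Fintype.ofFinite _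

/-- The payoffs at a terminal node. -/
def payoff : ∀ T : GameTree Info Act, T.Terminal → Fin 2 → ℝ
  | leaf w, _ => w
  | chance _ _ child, z => payoff (child z.1) z.2
  | decision _ _ child, z => payoff (child z.1) z.2

/-- The product of the probabilities of the chance moves on the path to a terminal node. -/
def chanceProb : ∀ T : GameTree Info Act, T.Terminal → ℝ
  | leaf _, _ => 1
  | chance _ p child, z => p z.1 * chanceProb (child z.1) z.2
  | decision _ _ child, z => chanceProb (child z.1) z.2

/-- The moves (information set, action) of each player on the path from the root to a terminal
node, root first. -/
def moves : ∀ T : GameTree Info Act, T.Terminal → ∀ j, List (Σ I : Info j, Act j I)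
  | leaf _, _ => fun _ => []
  | chance _ _ child, z => moves (child z.1) z.2
  | decision i I child, z => push i I z.1 (moves (child z.1) z.2)

end GameTree

/-- A two-player extensive-form game, possibly with chance moves (of positive probability). Every
information set contains at least one node, and there is at least one action at it. -/
structure Game where
  Info : Fin 2 → Type u
  Act : ∀ i, Info i → Type v
  [fintypeInfo : ∀ i, Fintype (Info i)]
  [fintypeAct : ∀ i I, Fintype (Act i I)]
  [nonemptyAct : ∀ i I, Nonempty (Act i I)]
  tree : GameTree Info Act
  chance_pos : ∀ h n p child, tree.At h (.chance n p child) → (∀ k, 0 < p k) ∧ ∑ k, p k = 1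
  info_occurs : ∀ i I, ∃ h child, tree.At h (.decision i I child)

namespace Game

attribute [instance] Game.fintypeInfo Game.fintypeAct Game.nonemptyAct

variable (G : Game.{u, v})

/-- Perfect recall: the paths to any two nodes of the same information set contain the same
sequence of moves of the player who acts there. -/
def PerfectRecall : Prop :=
  ∀ i I h child h' child', G.tree.At h (.decision i I child) →
    G.tree.At h' (.decision i I child') → h i = h' i

/-- The number of nodes of the game tree. -/
abbrev size : ℕ := G.tree.numNodes

/-- `Z`, the terminal states. -/
abbrev Z : Type v := G.tree.Terminal

/-- `Σ_i`, the sequences (information set, action) of player `i`. -/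
abbrev Seq (i : Fin 2) : Type (max u v) := Σ I : G.Info i, G.Act i I

/-- The triggers: pairs of a player `i` and a sequence in `Σ_i`. -/
abbrev Trigger : Type (max u v) := Σ i, G.Seq i

/-- The moves of player `i` on the path from the root to `z`. -/
abbrev own (i : Fin 2) (z : G.Z) : List (G.Seq i) := G.tree.moves z i

/-- `σ_i(z)`: the last sequence of player `i` on the path to `z`, if any. -/
def lastSeq (i : Fin 2) (z : G.Z) : Option (G.Seq i) := (G.own i z).getLast?

/-! ### Reduced-normal-form plans -/

variable {G} in
/-- The (partial) plan `π` prescribes all the moves in `l`. -/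
def Agrees {i : Fin 2} (π : ∀ I : G.Info i, Option (G.Act i I)) (l : List (G.Seq i)) : Prop :=
  ∀ σ ∈ l, π σ.1 = some σ.2

variable {G} in
/-- The plan `π` can lead to the information set `I` (if the other player and chance play to do
so as well). -/
def LeadsTo {i : Fin 2} (π : ∀ I : G.Info i, Option (G.Act i I)) (I : G.Info i) : Prop :=
  ∃ h child, G.tree.At h (.decision i I child) ∧ Agrees π (h i)

/-- `Π_i`: a pure reduced-normal-form plan prescribes an action exactly at those information
sets that it can lead to. -/
def Plan (i : Fin 2) : Type (max u v) :=
  {π : ∀ I : G.Info i, Option (G.Act i I) // ∀ I, (π I).isSome ↔ LeadsTo π I}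

noncomputable instance (i : Fin 2) : Fintype (G.Plan i) :=
  haveI : Finite (G.Plan i) :=
    inferInstanceAs (Finite {π : ∀ I : G.Info i, Option (G.Act i I) //
      ∀ I, (π I).isSome ↔ LeadsTo π I})
  Fintype.ofFinite _

/-- `Π_1 × Π_2`. -/
abbrev Profile : Type (max u v) := ∀ i, G.Plan i

/-- `Π_i(I)`: the plans that can lead to `I`. -/
def PlanTo {i : Fin 2} (I : G.Info i) : Type (max u v) := {π : G.Plan i // LeadsTo π.1 I}

noncomputable instance {i : Fin 2} (I : G.Info i) : Fintype (G.PlanTo I) :=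
  haveI : Finite (G.PlanTo I) := inferInstanceAs (Finite {π : G.Plan i // LeadsTo π.1 I})
  Fintype.ofFinite _

variable {G} in
/-- `π ∈ Π_i(I, a)` for `σ = (I, a)`: the plan can lead to `I` and prescribes `a` at `I`. -/
def Plan.ToSeq {i : Fin 2} (π : G.Plan i) (σ : G.Seq i) : Prop :=
  LeadsTo π.1 σ.1 ∧ π.1 σ.1 = some σ.2

variable {G} in
/-- `π ∈ Π_i(z)`: the plan can lead to the terminal state `z`. -/
def Plan.ToTerminal {i : Fin 2} (π : G.Plan i) (z : G.Z) : Prop := Agrees π.1 (G.own i z)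

/-- Distributions over `Π_1 × Π_2`. -/
abbrev CorrDist : Set (G.Profile → ℝ) := stdSimplex ℝ G.Profile

/-! ### Utilities, trigger agents, and extensive-form correlated equilibrium -/

variable {G} in
open Classical in
/-- The expected utility (over chance) of player `i` when the other player plays according to
`π` and player `i` behaves so that a path is compatible with this behaviour exactly when the list
of moves of player `i` on the path satisfies `B`. -/
noncomputable def util (i : Fin 2) (π : G.Profile) (B : List (G.Seq i) → Prop) : ℝ :=
  ∑ z : G.Z, if B (G.own i z) ∧ ∀ j, j ≠ i → (π j).ToTerminal z
    then G.tree.chanceProb z * G.tree.payoff z i else 0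

variable {G} in
/-- The expected utility of player `i` when both players follow the recommendations `μ`. -/
noncomputable def followUtil (i : Fin 2) (μ : G.Profile → ℝ) : ℝ :=
  ∑ π, μ π * util i π (Agrees (π i).1)

/-- A pure strategy of player `i` in the game extended by the correlation device, which reveals
the recommendation at an information set when it is reached, and reveals nothing more once the
player has deviated. `obey σ` is the action taken on the recommendation `σ = (I, a)` at `I` by a
player who has not deviated before (by perfect recall, `σ` then determines all the
recommendations seen so far); `alone σ J` is the action taken at `J` after the first deviation,
which took place on the recommendation `σ`. -/
structure Deviation (i : Fin 2) where
  obey : ∀ σ : G.Seq i, G.Act i σ.1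
  alone : G.Seq i → ∀ J : G.Info i, G.Act i J

variable {G} in
open Classical in
/-- The moves in the list are those of a player who uses `δ` while `π` is recommended. -/
def Deviation.Plays {i : Fin 2} (δ : G.Deviation i) (π : G.Plan i) : List (G.Seq i) → Prop
  | [] => True
  | σ :: l => ∃ r, π.1 σ.1 = some r ∧ δ.obey ⟨σ.1, r⟩ = σ.2 ∧
      if r = σ.2 then δ.Plays π l else ∀ τ ∈ l, δ.alone ⟨σ.1, r⟩ τ.1 = τ.2

variable {G} in
/-- `μ` is an extensive-form correlated equilibrium: following all recommendations is a best
response of each player among the strategies of the game extended by the device. -/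
def IsEFCE (μ : G.Profile → ℝ) : Prop :=
  ∀ (i : Fin 2) (δ : G.Deviation i), ∑ π, μ π * util i π (δ.Plays (π i)) ≤ followUtil i μ

variable {G} in
open Classical in
/-- The moves in the list are those of a trigger agent with trigger `s = (Î, â)` when `π` is
recommended and `ρ` is the plan sampled for the deviation: the agent follows `π`, but if `â` is
recommended at `Î`, it plays `ρ` from there on (including the move at `Î`). -/
def TriggerPlays {i : Fin 2} (s : G.Seq i) (π ρ : G.Plan i) : List (G.Seq i) → Prop
  | [] => True
  | σ :: l => if σ.1 = s.1 ∧ π.1 s.1 = some s.2 then Agrees ρ.1 (σ :: l)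
      else π.1 σ.1 = some σ.2 ∧ TriggerPlays s π ρ l

variable {G} in
/-- The expected utility of the `(s, ν)`-trigger agent of player `i`, where `ν` is a distribution
over the plans that can lead to the information set of `s`. -/
noncomputable def triggerUtil (i : Fin 2) (s : G.Seq i) (μ : G.Profile → ℝ)
    (ν : G.PlanTo s.1 → ℝ) : ℝ :=
  ∑ π, ∑ ρ, μ π * ν ρ * util i π (TriggerPlays s (π i) ρ.1)

/-! ### Correlation plans and sequence-form deviations -/

/-- The coordinates of a correlation plan: `ξ ⟨⟨i, σ⟩, z⟩` stands for `ξ_i(σ; z)`. -/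
abbrev XIdx : Type (max u v) := G.Trigger × G.Z

variable {G} in
open Classical in
/-- The correlation plan of `μ`: `ξ_i(σ; z)` is the probability that the plan of player `i` is in
`Π_i(σ)` and the plan of the other player can lead to `z`. -/
noncomputable def corrPlan (μ : G.Profile → ℝ) : G.XIdx → ℝ := fun x =>
  ∑ π, if (π x.1.1).ToSeq x.1.2 ∧ ∀ j, j ≠ x.1.1 → (π j).ToTerminal x.2 then μ π else 0

/-- `𝒳`, the set of correlation plans. -/
def X : Set (G.XIdx → ℝ) := corrPlan '' G.CorrDist

variable {G} in
/-- The correlation plan `ξ` is an EFCE: it is the correlation plan of an EFCE. -/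
def IsEFCEPlan (ξ : G.XIdx → ℝ) : Prop := ∃ μ ∈ G.CorrDist, corrPlan μ = ξ ∧ IsEFCE μ

/-- `Y_{i,s}` for the trigger `s = (Î, â)`: the sequence-form polytope of player `i`, restricted
to the strategies that reach `Î` with probability one as far as player `i` is concerned. At
every information set `I` the values of the sequences at `I` sum to the value of the last
sequence before `I`, or to `1` if there is none. -/
def SeqForm {i : Fin 2} (s : G.Seq i) : Set (G.Seq i → ℝ) :=
  {y | (∀ σ, 0 ≤ y σ) ∧
    (∀ I h child, G.tree.At h (.decision i I child) →
      ∑ a, y ⟨I, a⟩ = ((h i).getLast?).elim 1 y) ∧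
    ∑ a, y ⟨s.1, a⟩ = 1}

variable {G} in
open Classical in
/-- The sequence-form vector of a distribution over `Π_i(I)`: the value at `σ` is the probability
of `Π_i(σ)`. -/
noncomputable def seqOf {i : Fin 2} {I : G.Info i} (ν : G.PlanTo I → ℝ) : G.Seq i → ℝ :=
  fun σ => ∑ ρ, if ρ.1.ToSeq σ then ν ρ else 0

/-! ### The saddle-point problem -/

variable {G} in
open Classical in
/-- The deviation term `∑ u_i(z) ξ_i(s; z) y(z)`, over the terminal states `z` whose path passes
through the information set of `s`; here `y(z) = y(σ_i(z))`, and the payoffs are weighted by the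
chance probabilities. -/
noncomputable def gain {i : Fin 2} (s : G.Seq i) (ξ : G.XIdx → ℝ) (y : G.Seq i → ℝ) : ℝ :=
  ∑ z : G.Z, if ∃ a, (⟨s.1, a⟩ : G.Seq i) ∈ G.own i z
    then G.tree.chanceProb z * G.tree.payoff z i * ξ (⟨i, s⟩, z) * (G.lastSeq i z).elim 0 y else 0

variable {G} in
open Classical in
/-- The term `∑ u_i(z) ξ_i(σ_i(z); z)`, over the terminal states `z` whose path contains the
sequence `s`. -/
noncomputable def base {i : Fin 2} (s : G.Seq i) (ξ : G.XIdx → ℝ) : ℝ :=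
  ∑ z : G.Z, if s ∈ G.own i z
    then G.tree.chanceProb z * G.tree.payoff z i *
      (G.lastSeq i z).elim 0 (fun σ => ξ (⟨i, σ⟩, z)) else 0

variable {G} in
/-- The trigger value `v_{i,s}(ξ, y)`. -/
noncomputable def triggerValue {i : Fin 2} (s : G.Seq i) (ξ : G.XIdx → ℝ) (y : G.Seq i → ℝ) : ℝ :=
  gain s ξ y - base s ξ

variable {G} in
/-- The values of all deviations against `ξ`. -/
def deviationValues (ξ : G.XIdx → ℝ) : Set ℝ :=
  {r | ∃ (i : Fin 2) (s : G.Seq i), ∃ y ∈ G.SeqForm s, r = triggerValue s ξ y}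

variable {G} in
/-- `v*(ξ)`. -/
noncomputable def vStar (ξ : G.XIdx → ℝ) : ℝ := sSup (deviationValues ξ)

/-- The coordinates of `(λ, z)`: one multiplier `λ_{i,s}` for each trigger, and, for each trigger,
a vector `z_{i,s}` indexed by the sequences of player `i`. -/
abbrev YIdx : Type (max u v) := G.Trigger ⊕ (Σ i, G.Seq i × G.Seq i)

variable {G} in
/-- The multiplier `λ_{i,s}`. -/
def lam (w : G.YIdx → ℝ) (i : Fin 2) (s : G.Seq i) : ℝ := w (Sum.inl ⟨i, s⟩)

variable {G} in
/-- The vector `z_{i,s}`. -/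
def zvec (w : G.YIdx → ℝ) (i : Fin 2) (s : G.Seq i) : G.Seq i → ℝ :=
  fun τ => w (Sum.inr ⟨i, (s, τ)⟩)

/-- `𝒴`: the multipliers are in `[0, 1]` and sum to one, and `z_{i,s} ∈ λ_{i,s} Y_{i,s}`. -/
def Y : Set (G.YIdx → ℝ) :=
  {w | (∀ i s, lam w i s ∈ Set.Icc (0 : ℝ) 1) ∧
    ∑ i, ∑ s, lam w i s = 1 ∧
    ∀ i s, zvec w i s ∈ lam w i s • G.SeqForm s}

variable {G} in
/-- The objective of the saddle-point problem. -/
noncomputable def objective (ξ : G.XIdx → ℝ) (w : G.YIdx → ℝ) : ℝ :=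
  ∑ i, ∑ s, (gain s ξ (zvec w i s) - lam w i s * base s ξ)

end Game

/-- A polytope is the convex hull of a finite set of points. -/
def IsPolytope {ι : Type*} (S : Set (ι → ℝ)) : Prop :=
  ∃ V : Set (ι → ℝ), V.Finite ∧ S = convexHull ℝ V

/-! Under perfect recall all nodes of an information set `I` share one list of own moves, `hist I`.
A reduced plan is therefore compatible with a whole path as soon as it is compatible with the last
own sequence on it (`IsPath.agrees_iff_toSeq`), so probabilities of reaching `z` are single
coordinates of sequence-form vectors. Passing from such a vector to a behavioural strategy and its
product distribution (`exists_seqOf_eq`) identifies `SeqForm` with the distributions over plans.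
This makes `SeqForm`, `X` and `Y` linear images of simplices.

Utilities are compared path by path. A trigger agent changes the set of compatible paths only when
the trigger is recommended and the path meets its information set; `ind_triggerPlays` records the
change, and summation gives `triggerValue_eq`. For an arbitrary strategy in the extended game, a
path contains at most one first deviation, so the change of its indicator splits over the possible
first deviations (`ind_plays`). Each summand is the change caused by one trigger agent. Hence every
gain is a sum of trigger gains, and trigger agents suffice to test for EFCE.

Existence follows Hart and Schmeidler: in the zero-sum game of the device against mixtures of
trigger agents, it is enough to answer each fixed mixture. Each trigger agent acts as a self-map of
the plans of its player (`exists_plan_triggerPlays`), the mixture induces a Markov dynamics for each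
player, and the product of stationary distributions makes all gains cancel. Minimax then yields one
distribution good against all trigger agents.

Finally `vStar` is nonnegative on `X`, since at an information set with the longest history the
agent can deviate to exactly what was recommended (`exists_neutral_trigger`). So the optimal value
is 0, and this harmless deviation is the maximizer's half of a saddle point for every EFCE. -/

namespace GameTree

variable {Info : Fin 2 → Type u} {Act : ∀ i, Info i → Type v}

/-! ### Moves along a path of the tree -/

theorem push_self (i : Fin 2) (I : Info i) (a : Act i I) (h : ∀ j, List (Σ I : Info j, Act j I)) :
    push i I a h i = ⟨I, a⟩ :: h i :=
  Function.update_self ..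

theorem push_of_ne {i j : Fin 2} (hij : j ≠ i) (I : Info i) (a : Act i I)
    (h : ∀ j, List (Σ I : Info j, Act j I)) : push i I a h j = h j :=
  Function.update_of_ne hij ..

/-- Every own move on the path to a node is made at an earlier node of the path. -/
theorem At.exists_decision_of_split {T S : GameTree Info Act}
    {h : ∀ j, List (Σ I : Info j, Act j I)} (H : At T h S) (i : Fin 2) :
    ∀ {l : List (Σ I : Info i, Act i I)} {σ : Σ I : Info i, Act i I}
      {l' : List (Σ I : Info i, Act i I)}, h i = l ++ σ :: l' →
      ∃ h' child, At T h' (.decision i σ.1 child) ∧ h' i = l := by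
  induction H with
  | here T => intro l σ l' e; simp at e
  | chance k H ih =>
    intro l σ l' e
    obtain ⟨h', child, H', e'⟩ := ih e
    exact ⟨h', child, .chance k H', e'⟩
  | @decision j I child a h S H ih =>
    intro l σ l' e
    by_cases hij : i = j
    · subst hij
      rw [push_self] at e
      cases l with
      | nil =>
        obtain ⟨rfl, -⟩ := List.cons.inj e
        exact ⟨_, child, .here _, rfl⟩
      | cons τ l =>
        obtain ⟨rfl, e₂⟩ := List.cons.inj e
        obtain ⟨h', child', H', e'⟩ := ih e₂
        exact ⟨_, child', .decision a H', by rw [push_self, e']⟩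
    · rw [push_of_ne hij] at e
      obtain ⟨h', child', H', e'⟩ := ih e
      exact ⟨_, child', .decision a H', by rw [push_of_ne hij, e']⟩

theorem at_moves (T : GameTree Info Act) (z : T.Terminal) : ∃ w, T.At (T.moves z) (.leaf w) := by
  induction T with
  | leaf w => exact ⟨w, .here _⟩
  | chance n p child ih =>
    obtain ⟨w, H⟩ := ih z.1 z.2
    exact ⟨w, .chance z.1 H⟩
  | decision i I child ih =>
    obtain ⟨w, H⟩ := ih z.1 z.2
    exact ⟨w, .decision z.1 H⟩

/-! ### Counting terminal nodes and sequences -/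

section Counting

variable [∀ i I, Fintype (Act i I)]

theorem card_terminal_le (T : GameTree Info Act) : Fintype.card T.Terminal ≤ T.numNodes := by
  rw [← Nat.card_eq_fintype_card]
  induction T with
  | leaf w => exact (Nat.card_unique (α := PUnit)).le
  | chance n p child ih =>
    have : Nat.card (chance n p child).Terminal = ∑ k, Nat.card (child k).Terminal :=
      Nat.card_sigma (β := fun k => (child k).Terminal)
    rw [this, numNodes]
    exact (Finset.sum_le_sum fun k _ => ih k).trans (Nat.le_add_left _ _)
  | decision i I child ih =>
    have : Nat.card (decision i I child).Terminal = ∑ k, Nat.card (child k).Terminal :=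
      Nat.card_sigma (β := fun k => (child k).Terminal)
    rw [this, numNodes]
    exact (Finset.sum_le_sum fun k _ => ih k).trans (Nat.le_add_left _ _)

open Classical in
/-- There are fewer sequences occurring in a tree than nodes. -/
theorem exists_finset_sequences (T : GameTree Info Act) :
    ∃ s : Finset (Σ i, Σ I : Info i, Act i I), s.card + 1 ≤ T.numNodes ∧
      ∀ i I h child, T.At h (.decision i I child) → ∀ a, (⟨i, I, a⟩ : Σ i, Σ I, Act i I) ∈ s := by
  induction T with
  | leaf w =>
    refine ⟨∅, by simp [numNodes], fun i I h child H a => ?_⟩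
    cases H
  | chance n p child ih =>
    choose s hs hmem using ih
    refine ⟨Finset.univ.biUnion s, ?_, fun i I h child H a => ?_⟩
    · rw [numNodes, add_comm]
      exact Nat.add_le_add_left (Finset.card_biUnion_le.trans
        (Finset.sum_le_sum fun k _ => (Nat.le_succ _).trans (hs k))) _
    · cases H with
      | chance k H => exact Finset.mem_biUnion.2 ⟨k, Finset.mem_univ _, hmem k i I _ _ H a⟩
  | decision j J child ih =>
    choose s hs hmem using ih
    refine ⟨Finset.univ.image (fun a : Act j J => (⟨j, J, a⟩ : Σ i, Σ I, Act i I)) ∪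
      Finset.univ.biUnion s, ?_, fun i I h child H a => ?_⟩
    · rw [numNodes, add_comm]
      refine Nat.add_le_add_left ((Finset.card_union_le _ _).trans ?_) _
      -- The spare `+ 1` of each subtree, its root, pays for the action leading to it.
      calc _ ≤ Fintype.card (Act j J) + ∑ a, (s a).card :=
            Nat.add_le_add Finset.card_image_le Finset.card_biUnion_le
        _ = ∑ a, ((s a).card + 1) := by simp [Finset.sum_add_distrib, add_comm]
        _ ≤ _ := Finset.sum_le_sum fun k _ => hs k
    · cases H with
      | here => exact Finset.mem_union_left _ (Finset.mem_image_of_mem _ (Finset.mem_univ a))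
      | decision b H =>
        exact Finset.mem_union_right _ (Finset.mem_biUnion.2 ⟨b, Finset.mem_univ _, hmem b i I _ _ H a⟩)

end Counting

end GameTree

namespace Game

variable {G : Game.{u, v}} {i : Fin 2}

/-! ### Dimensions of the coordinate spaces -/

theorem card_trigger_lt_size (G : Game.{u, v}) : Fintype.card G.Trigger + 1 ≤ G.size := by
  obtain ⟨s, hs, hmem⟩ := G.tree.exists_finset_sequences
  refine le_trans (Nat.add_le_add_right ?_ 1) hs
  refine Finset.card_le_card fun t _ => ?_
  obtain ⟨h, child, H⟩ := G.info_occurs t.1 t.2.1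
  exact hmem t.1 t.2.1 h child H t.2.2

theorem card_xIdx_le (G : Game.{u, v}) : Fintype.card G.XIdx ≤ G.size ^ 2 := by
  have h1 := G.card_trigger_lt_size
  have h2 := G.tree.card_terminal_le
  rw [Fintype.card_prod, sq]
  exact Nat.mul_le_mul (by lia) h2

theorem card_yIdx_le (G : Game.{u, v}) : Fintype.card G.YIdx ≤ G.size ^ 2 := by
  have h1 := G.card_trigger_lt_size
  rw [Fintype.card_sigma, Fin.sum_univ_two] at h1
  rw [Fintype.card_sum, Fintype.card_sigma, Fintype.card_sigma, Fin.sum_univ_two,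
    Fin.sum_univ_two, Fintype.card_prod, Fintype.card_prod]
  -- With `m` and `n` sequences of the two players, `m + n + m² + n² ≤ (m + n + 1)²`.
  nlinarith

/-! ### Histories and paths of a player -/

/-- The moves of player `i` on the path to (some node of) the information set `I`. -/
noncomputable def hist (I : G.Info i) : List (G.Seq i) := (G.info_occurs i I).choose i

theorem hist_spec (I : G.Info i) :
    ∃ h child, G.tree.At h (.decision i I child) ∧ h i = hist I :=
  ⟨_, (G.info_occurs i I).choose_spec.choose, (G.info_occurs i I).choose_spec.choose_spec, rfl⟩

theorem PerfectRecall.eq_hist (hG : G.PerfectRecall) {I : G.Info i}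
    {h : ∀ j, List (G.Seq j)} {child : G.Act i I → GameTree G.Info G.Act}
    (H : G.tree.At h (.decision i I child)) : h i = hist I := by
  obtain ⟨h', child', H', e⟩ := hist_spec I
  exact (hG i I h child h' child' H H').trans e

/-- A list of moves is a path if the moves before each move are the history of its information
set. -/
def IsPath (L : List (G.Seq i)) : Prop :=
  ∀ l σ l', L = l ++ σ :: l' → hist σ.1 = l

/-- Each own move is made at an earlier node of the path, and perfect recall identifies the moves
before that node with the history. -/
theorem PerfectRecall.isPath_of_at (hG : G.PerfectRecall) {h : ∀ j, List (G.Seq j)}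
    {S : GameTree G.Info G.Act} (H : G.tree.At h S) : IsPath (h i) := by
  intro l σ l' e
  obtain ⟨h', child, H', rfl⟩ := H.exists_decision_of_split i e
  exact (hG.eq_hist H').symm

theorem PerfectRecall.isPath_own (hG : G.PerfectRecall) (z : G.Z) : IsPath (G.own i z) :=
  let ⟨_, H⟩ := G.tree.at_moves z
  hG.isPath_of_at H

theorem PerfectRecall.isPath_hist (hG : G.PerfectRecall) (I : G.Info i) : IsPath (hist I) := by
  obtain ⟨h, child, H, e⟩ := hist_spec I
  exact e ▸ hG.isPath_of_at H

theorem PerfectRecall.leadsTo_iff (hG : G.PerfectRecall)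
    {π : ∀ I : G.Info i, Option (G.Act i I)} {I : G.Info i} :
    LeadsTo π I ↔ Agrees π (hist I) := by
  constructor
  · rintro ⟨h, child, H, hA⟩
    rwa [hG.eq_hist H] at hA
  · intro hA
    obtain ⟨h, child, H, e⟩ := hist_spec I
    exact ⟨h, child, H, e ▸ hA⟩

theorem PerfectRecall.isSome_iff (hG : G.PerfectRecall) (π : G.Plan i) (I : G.Info i) :
    (π.1 I).isSome ↔ Agrees π.1 (hist I) :=
  (π.2 I).trans hG.leadsTo_iff

theorem PerfectRecall.agrees_hist_of_eq_some (hG : G.PerfectRecall) (π : G.Plan i) {I : G.Info i}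
    {a : G.Act i I} (h : π.1 I = some a) : Agrees π.1 (hist I) :=
  (hG.isSome_iff π I).1 (by simp [h])

/-- A reduced plan prescribes actions only where it can lead, so reachability comes for free. -/
theorem PerfectRecall.toSeq_iff (hG : G.PerfectRecall) (π : G.Plan i) (σ : G.Seq i) :
    π.ToSeq σ ↔ π.1 σ.1 = some σ.2 :=
  ⟨fun h => h.2, fun h => ⟨hG.leadsTo_iff.2 (hG.agrees_hist_of_eq_some π h), h⟩⟩

theorem agrees_append {π : ∀ I : G.Info i, Option (G.Act i I)} {l l' : List (G.Seq i)} :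
    Agrees π (l ++ l') ↔ Agrees π l ∧ Agrees π l' := by
  simp only [Agrees, List.mem_append, or_imp, forall_and]

theorem agrees_cons {π : ∀ I : G.Info i, Option (G.Act i I)} {σ : G.Seq i} {l : List (G.Seq i)} :
    Agrees π (σ :: l) ↔ π σ.1 = some σ.2 ∧ Agrees π l := by
  simp only [Agrees, List.mem_cons, forall_eq_or_imp]

theorem agrees_nil {π : ∀ I : G.Info i, Option (G.Act i I)} : Agrees π [] := by
  simp [Agrees]

namespace IsPath

variable {L l l' : List (G.Seq i)}

theorem of_append (h : IsPath (l ++ l')) : IsPath l := fun l₁ σ l₂ e =>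
  h l₁ σ (l₂ ++ l') (by simp [e])

theorem exists_split (h : IsPath L) {σ : G.Seq i} (hσ : σ ∈ L) : ∃ l', L = hist σ.1 ++ σ :: l' := by
  obtain ⟨l, l', e⟩ := List.append_of_mem hσ
  exact ⟨l', by rw [h l σ l' e]; exact e⟩

theorem eq_of_fst_eq (h : IsPath L) {σ τ : G.Seq i} (hσ : σ ∈ L) (hτ : τ ∈ L)
    (e : σ.1 = τ.1) : σ = τ := by
  obtain ⟨l₁, h₁⟩ := h.exists_split hσ
  obtain ⟨l₂, h₂⟩ := h.exists_split hτ
  rw [h₁, e] at h₂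
  exact (List.cons.inj (List.append_cancel_left h₂)).1

theorem hist_subset (h : IsPath L) {σ τ : G.Seq i} (hσ : σ ∈ L) (hτ : τ ∈ hist σ.1) : τ ∈ L := by
  obtain ⟨l₁, h₁⟩ := h.exists_split hσ
  rw [h₁]
  exact List.mem_append_left _ hτ

/-- The moves before the last one are the history of its information set, so leading there already
means agreeing with them. -/
theorem agrees_iff_toSeq (hG : G.PerfectRecall) (h : IsPath L) {σ : G.Seq i}
    (hσ : L.getLast? = some σ) (π : G.Plan i) : Agrees π.1 L ↔ π.ToSeq σ := by
  obtain ⟨l, rfl⟩ := List.getLast?_eq_some_iff.1 hσ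
  rw [Plan.ToSeq, hG.leadsTo_iff, h l σ [] rfl, agrees_append, agrees_cons]
  simp [agrees_nil]

end IsPath

/-- Otherwise `hist I` would be a proper prefix of itself. -/
theorem notMem_hist_self (hG : G.PerfectRecall) (I : G.Info i) (a : G.Act i I) :
    (⟨I, a⟩ : G.Seq i) ∉ hist I := by
  intro h
  obtain ⟨l, e⟩ := (hG.isPath_hist I).exists_split h
  have := congrArg List.length e
  simp at this

/-! ### Reduced plans of full strategies -/

open Classical in
/-- The reduced-normal-form plan of a strategy that prescribes an action everywhere. -/
noncomputable def PerfectRecall.ofPure (hG : G.PerfectRecall) (f : ∀ I : G.Info i, G.Act i I) :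
    G.Plan i :=
  ⟨fun I => if ∀ σ ∈ hist I, f σ.1 = σ.2 then some (f I) else none, fun I => by
    rw [hG.leadsTo_iff]
    constructor
    · intro h σ hσ
      have h' : ∀ σ ∈ hist I, f σ.1 = σ.2 := by
        by_contra hc
        simp [hc] at h
      beta_reduce
      rw [if_pos fun τ hτ => h' τ ((hG.isPath_hist I).hist_subset hσ hτ), h' σ hσ]
    · intro h
      have h' : ∀ σ ∈ hist I, f σ.1 = σ.2 := by
        intro σ hσ
        have := h σ hσ
        beta_reduce at this
        split_ifs at this
        simpa using this
      beta_reduce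
      rw [if_pos h']
      rfl⟩

theorem PerfectRecall.agrees_ofPure (hG : G.PerfectRecall) (f : ∀ I : G.Info i, G.Act i I)
    {L : List (G.Seq i)} (hL : IsPath L) :
    Agrees (hG.ofPure f).1 L ↔ ∀ σ ∈ L, f σ.1 = σ.2 := by
  classical
  constructor
  · intro h σ hσ
    have := h σ hσ
    simp only [PerfectRecall.ofPure] at this
    split_ifs at this
    simpa using this
  · intro h σ hσ
    simp only [PerfectRecall.ofPure]
    rw [if_pos fun τ hτ => h τ (hL.hist_subset hσ hτ), h σ hσ]

/-- An extension of a reduced plan to all information sets. -/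
noncomputable def Plan.extend (π : G.Plan i) (I : G.Info i) : G.Act i I :=
  (π.1 I).getD (Classical.arbitrary _)

theorem Plan.extend_of_eq_some {π : G.Plan i} {I : G.Info i} {a : G.Act i I}
    (h : π.1 I = some a) : π.extend I = a := by
  simp [Plan.extend, h]

/-- The arbitrary values of `Plan.extend` are never met: a plan agreeing with the moves before `σ`
leads to `σ.1`, hence prescribes an action there. -/
theorem PerfectRecall.agrees_iff_extend (hG : G.PerfectRecall) (π : G.Plan i)
    {L : List (G.Seq i)} (hL : IsPath L) :
    Agrees π.1 L ↔ ∀ σ ∈ L, π.extend σ.1 = σ.2 := by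
  refine ⟨fun h σ hσ => Plan.extend_of_eq_some (h σ hσ), fun h => ?_⟩
  induction L using List.reverseRecOn with
  | nil => exact agrees_nil
  | append_singleton l σ ih =>
    have hl : Agrees π.1 l := ih hL.of_append fun τ hτ => h τ (List.mem_append_left _ hτ)
    refine agrees_append.2 ⟨hl, agrees_cons.2 ⟨?_, agrees_nil⟩⟩
    have hs : (π.1 σ.1).isSome := by
      rw [hG.isSome_iff, hL l σ [] rfl]
      exact hl
    obtain ⟨a, ha⟩ := Option.isSome_iff_exists.1 hs
    rw [ha, ← h σ (by simp), Plan.extend_of_eq_some ha]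

/-- A plan that leads to `I` and follows the full strategy `g` from there on. -/
theorem PerfectRecall.exists_planTo (hG : G.PerfectRecall) (I : G.Info i)
    (g : ∀ J : G.Info i, G.Act i J) :
    ∃ ρ : G.PlanTo I, ∀ a l', IsPath (hist I ++ ⟨I, a⟩ :: l') →
      (Agrees ρ.1.1 (hist I ++ ⟨I, a⟩ :: l') ↔ ∀ τ ∈ (⟨I, a⟩ : G.Seq i) :: l', g τ.1 = τ.2) := by
  classical
  -- Play towards `I` at the information sets before it, and `g` elsewhere.
  let f : ∀ J : G.Info i, G.Act i J := fun J =>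
    if h : ∃ a, (⟨J, a⟩ : G.Seq i) ∈ hist I then h.choose else g J
  have hf : ∀ σ ∈ hist I, f σ.1 = σ.2 := by
    intro σ hσ
    have h : ∃ a, (⟨σ.1, a⟩ : G.Seq i) ∈ hist I := ⟨σ.2, hσ⟩
    have := (hG.isPath_hist I).eq_of_fst_eq h.choose_spec hσ rfl
    simp only [f, dif_pos h]
    exact eq_of_heq (Sigma.mk.inj_iff.1 this).2
  refine ⟨⟨hG.ofPure f, hG.leadsTo_iff.2 ((hG.agrees_ofPure f (hG.isPath_hist I)).2 hf)⟩, ?_⟩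
  intro a l' hp
  rw [hG.agrees_ofPure f hp]
  -- No information set from `I` on occurs in `hist I`: its history would have to be both at least
  -- as long as `hist I` and strictly shorter.
  have key : ∀ τ ∈ (⟨I, a⟩ : G.Seq i) :: l', f τ.1 = g τ.1 := by
    intro τ hτ
    refine dif_neg ?_
    rintro ⟨b, hb⟩
    have h2 : (⟨τ.1, b⟩ : G.Seq i) = τ :=
      hp.eq_of_fst_eq (List.mem_append_left _ hb) (List.mem_append_right _ hτ) rfl
    rw [h2] at hb
    obtain ⟨l₁, l₂, e⟩ := List.append_of_mem hτ
    have h3 := hp (hist I ++ l₁) τ l₂ (by rw [e]; simp)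
    obtain ⟨l₃, h4⟩ := (hG.isPath_hist I).exists_split hb
    have := congrArg List.length (h3 ▸ h4)
    simp at this
  constructor
  · intro h τ hτ
    rw [← key τ hτ]
    exact h τ (List.mem_append_right _ hτ)
  · intro h τ hτ
    rcases List.mem_append.1 hτ with h1 | h1
    · exact hf τ h1
    · rw [key τ h1]
      exact h τ h1

end Game

/-! ### Simplices, minimax, and bilinear forms -/

theorem isPolytope_image_stdSimplex {κ ι : Type*} [Fintype κ] (L : (κ → ℝ) →ₗ[ℝ] (ι → ℝ)) :
    IsPolytope (L '' stdSimplex ℝ κ) := by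
  classical
  refine ⟨L '' Set.range fun k : κ => Pi.single k (1 : ℝ), (Set.finite_range _).image _, ?_⟩
  rw [← LinearMap.image_convexHull, convexHull_rangle_single_eq_stdSimplex]

theorem isPolytope_image_stdSimplex_of_eq {κ ι : Type*} [Fintype κ] (A : κ → ι → ℝ)
    (F : (κ → ℝ) → ι → ℝ) (hF : ∀ x j, F x j = ∑ k, x k * A k j) :
    IsPolytope (F '' stdSimplex ℝ κ) := by
  have : F = Matrix.vecMulLinear (Matrix.of A) := by
    ext x j
    simp [hF, Matrix.vecMul, dotProduct]
  rw [this]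
  exact isPolytope_image_stdSimplex _

theorem IsPolytope.isCompact {ι : Type*} [Finite ι] {S : Set (ι → ℝ)} (h : IsPolytope S) :
    IsCompact S := by
  have := Fintype.ofFinite ι
  obtain ⟨V, hV, rfl⟩ := h
  exact hV.isCompact_convexHull ℝ

theorem exists_dotProduct_mulVec_eq {m n : Type*} [Fintype m] [Fintype n]
    (B : (m → ℝ) → (n → ℝ) → ℝ) (h₁ : ∀ x x' y, B (x + x') y = B x y + B x' y)
    (h₂ : ∀ (c : ℝ) x y, B (c • x) y = c * B x y) (h₃ : ∀ x y y', B x (y + y') = B x y + B x y')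
    (h₄ : ∀ (c : ℝ) x y, B x (c • y) = c * B x y) :
    ∃ M : Matrix m n ℝ, ∀ x y, B x y = x ⬝ᵥ (M *ᵥ y) := by
  classical
  let B' := LinearMap.mk₂ ℝ B h₁ h₂ h₃ h₄
  refine ⟨LinearMap.toMatrix₂' ℝ B', fun x y => ?_⟩
  rw [← Matrix.toLinearMap₂'_apply', Matrix.toLinearMap₂'_toMatrix']
  rfl

/-- If every mixture of the columns of `A` is nonpositive against some mixed row, then some mixed
row makes all columns nonpositive. -/
theorem exists_mem_stdSimplex_forall_sum_nonpos {κ τ : Type*} [Fintype κ] [Fintype τ] [Nonempty κ]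
    (A : κ → τ → ℝ)
    (h : ∀ c ∈ stdSimplex ℝ τ, ∃ x ∈ stdSimplex ℝ κ, ∑ k, x k * ∑ t, c t * A k t ≤ 0) :
    ∃ x ∈ stdSimplex ℝ κ, ∀ t, ∑ k, x k * A k t ≤ 0 := by
  classical
  obtain ⟨k₀⟩ := ‹Nonempty κ›
  cases isEmpty_or_nonempty τ with
  | inl hτ => exact ⟨Pi.single k₀ 1, single_mem_stdSimplex ℝ k₀, fun t => hτ.elim t⟩
  | inr hτ =>
    obtain ⟨t₀⟩ := hτ
    obtain ⟨x, hx, c, hc, hxc⟩ := Sion.exists_isSaddlePointOn (X := stdSimplex ℝ κ)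
      (Y := stdSimplex ℝ τ) (f := fun x c => ∑ k, x k * ∑ t, c t * A k t)
      ⟨_, single_mem_stdSimplex ℝ k₀⟩ (convex_stdSimplex ℝ κ) (isCompact_stdSimplex ℝ κ)
      (fun c _ => (Continuous.lowerSemicontinuous (by fun_prop)).lowerSemicontinuousOn _)
      (fun c _ => ConvexOn.quasiconvexOn ⟨convex_stdSimplex ℝ κ, fun x _ y _ a b _ _ _ => le_of_eq
        (by simp [Finset.mul_sum, Finset.sum_add_distrib, add_mul, mul_assoc])⟩)
      (convex_stdSimplex ℝ τ) ⟨_, single_mem_stdSimplex ℝ t₀⟩ (isCompact_stdSimplex ℝ τ)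
      (fun c _ => (Continuous.upperSemicontinuous (by fun_prop)).upperSemicontinuousOn _)
      (fun c _ => ConcaveOn.quasiconcaveOn ⟨convex_stdSimplex ℝ τ, fun x _ y _ a b _ _ _ =>
        le_of_eq (by
          simp only [Finset.mul_sum, Finset.sum_add_distrib, add_mul, mul_add, Pi.add_apply,
            Pi.smul_apply, smul_eq_mul, mul_assoc, mul_left_comm])⟩)
    -- The value at the saddle point is nonpositive because `x'` answers `c`, and it bounds every
    -- pure column against `x`.
    obtain ⟨x', hx', hle⟩ := h c hc
    refine ⟨x, hx, fun t => ?_⟩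
    have := hxc x' hx' (Pi.single t 1) (single_mem_stdSimplex ℝ t)
    simp only [Pi.single_apply, ite_mul, one_mul, zero_mul, Finset.sum_ite_eq',
      Finset.mem_univ, if_true] at this
    exact this.trans hle

/-- A nonnegative combination of self-maps of a finite set has a stationary distribution. -/
theorem exists_stationary {κ τ : Type*} [Fintype κ] [Nonempty κ] [Fintype τ] (φ : τ → κ → κ)
    {c : τ → ℝ} (hc : ∀ t, 0 ≤ c t) :
    ∃ x ∈ stdSimplex ℝ κ, ∀ g : κ → ℝ, ∑ t, c t * ∑ k, x k * (g (φ t k) - g k) = 0 := by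
  classical
  -- `A k q` is the net flow into `q` caused by unit mass at `k`; stationarity means that the
  -- averaged flow vanishes at every `q`.
  let A : κ → κ → ℝ := fun k q =>
    ∑ t, c t * ((if φ t k = q then 1 else 0) - if k = q then 1 else 0)
  have hA : ∀ (g : κ → ℝ) k, ∑ q, g q * A k q = ∑ t, c t * (g (φ t k) - g k) := by
    intro g k
    simp only [A, Finset.mul_sum]
    rw [Finset.sum_comm]
    refine Finset.sum_congr rfl fun t _ => ?_
    simp only [mul_left_comm _ (c t), ← Finset.mul_sum]
    simp [mul_sub]
  obtain ⟨x, hx, hle⟩ := exists_mem_stdSimplex_forall_sum_nonpos A fun d _ => by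
    -- From a maximum of `d` every map can only decrease `d`.
    obtain ⟨k₀, hk₀⟩ := Finite.exists_max d
    refine ⟨Pi.single k₀ 1, single_mem_stdSimplex ℝ k₀, ?_⟩
    simp only [Pi.single_apply, ite_mul, one_mul, zero_mul, Finset.sum_ite_eq',
      Finset.mem_univ, if_true, hA]
    exact Finset.sum_nonpos fun t _ =>
      mul_nonpos_of_nonneg_of_nonpos (hc t) (sub_nonpos.2 (hk₀ _))
  have hsum : ∀ g : κ → ℝ, ∑ q, g q * ∑ k, x k * A k q =
      ∑ t, c t * ∑ k, x k * (g (φ t k) - g k) := by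
    intro g
    calc _ = ∑ k, x k * ∑ q, g q * A k q := by
          simp only [Finset.mul_sum]
          rw [Finset.sum_comm]
          exact Finset.sum_congr rfl fun _ _ => Finset.sum_congr rfl fun _ _ => by ring
      _ = _ := by
          simp only [hA, Finset.mul_sum]
          rw [Finset.sum_comm]
          exact Finset.sum_congr rfl fun _ _ => Finset.sum_congr rfl fun _ _ => by ring
  -- The net flows are nonpositive, and mass conservation (`g = 1`) makes their sum zero.
  have hzero : ∀ q, ∑ k, x k * A k q = 0 := by
    have h1 := hsum fun _ => 1
    simp only [one_mul, sub_self, mul_zero, Finset.sum_const_zero] at h1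
    exact fun q => (Finset.sum_eq_zero_iff_of_nonpos fun q _ => hle q).1 h1 q (Finset.mem_univ q)
  exact ⟨x, hx, fun g => by rw [← hsum]; simp [hzero]⟩

namespace Game

variable {G : Game.{u, v}} {i : Fin 2}

/-! ### Realization equivalence: the sequence form and distributions over plans -/

theorem PerfectRecall.mem_seqForm_iff (hG : G.PerfectRecall) {s : G.Seq i} {y : G.Seq i → ℝ} :
    y ∈ G.SeqForm s ↔ (∀ σ, 0 ≤ y σ) ∧
      (∀ I, ∑ a, y ⟨I, a⟩ = ((hist I).getLast?).elim 1 y) ∧ ∑ a, y ⟨s.1, a⟩ = 1 := by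
  refine and_congr_right fun _ => and_congr_left fun _ => ⟨fun h I => ?_, fun h I h' child H => ?_⟩
  · obtain ⟨h', child, H, e⟩ := hist_spec I
    rw [← e]
    exact h I h' child H
  · rw [hG.eq_hist H]
    exact h I

open Classical in
theorem PerfectRecall.sum_toSeq (hG : G.PerfectRecall) (ρ : G.Plan i) (I : G.Info i) :
    (∑ a, if ρ.ToSeq ⟨I, a⟩ then (1 : ℝ) else 0) = if LeadsTo ρ.1 I then 1 else 0 := by
  simp only [hG.toSeq_iff]
  by_cases h : LeadsTo ρ.1 I
  · obtain ⟨a, ha⟩ := Option.isSome_iff_exists.1 ((ρ.2 I).2 h)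
    simp [h, ha]
  · have : ρ.1 I = none := by
      rw [← Option.not_isSome_iff_eq_none, ρ.2 I]
      exact h
    simp [h, this]

open Classical in
theorem seqOf_apply {I : G.Info i} (ν : G.PlanTo I → ℝ) (σ : G.Seq i) :
    seqOf ν σ = ∑ ρ, ν ρ * if ρ.1.ToSeq σ then 1 else 0 := by
  simp [seqOf]

/-- Both sides of the flow constraint at `I` are the probability of leading to `I`, which is the
same event as `ToSeq` of the last sequence before `I`. -/
theorem PerfectRecall.seqOf_mem_seqForm (hG : G.PerfectRecall) (s : G.Seq i)
    {ν : G.PlanTo s.1 → ℝ} (hν : ν ∈ stdSimplex ℝ (G.PlanTo s.1)) : seqOf ν ∈ G.SeqForm s := by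
  classical
  have hsum : ∀ I, ∑ a, seqOf ν ⟨I, a⟩ = ∑ ρ, ν ρ * if LeadsTo ρ.1.1 I then 1 else 0 := by
    intro I
    simp only [seqOf_apply]
    rw [Finset.sum_comm]
    exact Finset.sum_congr rfl fun ρ _ => by rw [← Finset.mul_sum, hG.sum_toSeq]
  refine hG.mem_seqForm_iff.2 ⟨fun σ => ?_, fun I => ?_, ?_⟩
  · exact Finset.sum_nonneg fun ρ _ => by split_ifs <;> simp [hν.1 ρ]
  · rw [hsum]
    cases e : (hist I).getLast? with
    | none =>
      have h0 : hist I = [] := List.getLast?_eq_none_iff.1 e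
      simp [hG.leadsTo_iff, h0, agrees_nil, hν.2]
    | some σ =>
      simp only [Option.elim, seqOf_apply, hG.leadsTo_iff,
        (hG.isPath_hist I).agrees_iff_toSeq hG e]
  · rw [hsum]
    refine Eq.trans ?_ hν.2
    exact Finset.sum_congr rfl fun ρ _ => by rw [if_pos ρ.2, mul_one]

section Product

variable {ι : Type*} [Fintype ι] {α : ι → Type*} [∀ j, Fintype (α j)]

open Classical in
/-- The probability, under the product distribution `∏ b`, of choosing all the elements of `L`. -/
theorem sum_prod_ite_eq_prod (b : ∀ j, α j → ℝ) (hb : ∀ j, ∑ a, b j a = 1) :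
    ∀ L : List (Σ j, α j), (L.map Sigma.fst).Nodup →
    (∑ f : ∀ j, α j, if ∀ σ ∈ L, f σ.1 = σ.2 then ∏ j, b j (f j) else 0) =
      (L.map fun σ => b σ.1 σ.2).prod := by
  -- The indicator factors over the coordinates, so the sum of products becomes a product of sums.
  -- Comparing dependent pairs avoids transporting actions between information sets.
  have expand : ∀ L : List (Σ j, α j),
      (∑ f : ∀ j, α j, if ∀ σ ∈ L, f σ.1 = σ.2 then ∏ j, b j (f j) else 0) =
        ∏ j, ∑ a, if ∀ σ ∈ L, σ.1 = j → σ = ⟨j, a⟩ then b j a else 0 := by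
    intro L
    rw [Finset.prod_univ_sum, Fintype.piFinset_univ]
    refine Finset.sum_congr rfl fun f _ => ?_
    split_ifs with h
    · refine Finset.prod_congr rfl fun j _ => (if_pos ?_).symm
      rintro σ hσ rfl
      exact Sigma.ext rfl (heq_of_eq (h σ hσ).symm)
    · push Not at h
      obtain ⟨σ, hσ, hne⟩ := h
      refine (Finset.prod_eq_zero (Finset.mem_univ σ.1) (if_neg fun h' => hne ?_)).symm
      exact (eq_of_heq (Sigma.mk.inj_iff.1 (h' σ hσ rfl)).2).symm
  intro L hL
  rw [expand]
  induction L with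
  | nil => simp [hb]
  | cons σ L ih =>
    rw [List.map_cons, List.nodup_cons] at hL
    rw [List.map_cons, List.prod_cons, ← ih hL.2, ← Finset.mul_prod_erase _ _ (Finset.mem_univ σ.1),
      ← Finset.mul_prod_erase Finset.univ (fun j => ∑ a, if ∀ σ ∈ L, σ.1 = j → σ = ⟨j, a⟩
        then b j a else 0) (Finset.mem_univ σ.1), ← mul_assoc]
    have hnot : ∀ τ ∈ L, τ.1 ≠ σ.1 := fun τ hτ e => hL.1 (e ▸ List.mem_map_of_mem hτ)
    congr 1
    · have h1 : ∀ a, (∀ τ ∈ L, τ.1 = σ.1 → τ = ⟨σ.1, a⟩) := fun a τ hτ e => absurd e (hnot τ hτ)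
      have h2 : ∀ a, (∀ τ ∈ σ :: L, τ.1 = σ.1 → τ = ⟨σ.1, a⟩) ↔ σ.2 = a := by
        intro a
        rw [List.forall_mem_cons]
        exact ⟨fun h => eq_of_heq (Sigma.mk.inj_iff.1 (h.1 rfl)).2,
          fun h => ⟨fun _ => h ▸ rfl, h1 a⟩⟩
      simp_rw [if_pos (h1 _), h2, hb, mul_one]
      simp
    · refine Finset.prod_congr rfl fun j hj => Finset.sum_congr rfl fun a _ => ?_
      have hne : σ.1 ≠ j := (Finset.ne_of_mem_erase hj).symm
      simp [hne]

end Product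

theorem IsPath.nodup_map_fst {L : List (G.Seq i)} (h : IsPath L) : (L.map Sigma.fst).Nodup := by
  induction L using List.reverseRecOn with
  | nil => simp
  | append_singleton l σ ih =>
    rw [List.map_append, List.nodup_append]
    refine ⟨ih h.of_append, by simp, ?_⟩
    intro I hI J hJ e
    obtain ⟨τ, hτ, rfl⟩ := List.mem_map.1 hI
    simp only [List.map_cons, List.map_nil, List.mem_singleton] at hJ
    subst hJ
    have e' : τ = σ := h.eq_of_fst_eq (List.mem_append_left _ hτ) (by simp) e
    subst e'
    obtain ⟨l', h1⟩ := h.of_append.exists_split hτ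
    rw [h l τ [] rfl] at h1
    have := congrArg List.length h1
    simp at this

theorem PerfectRecall.isPath_hist_concat (hG : G.PerfectRecall) (σ : G.Seq i) :
    IsPath (hist σ.1 ++ [σ]) := by
  intro l τ l' e
  rcases List.eq_nil_or_concat l' with rfl | ⟨l'', τ', rfl⟩
  · obtain ⟨rfl, h⟩ := List.append_inj' e rfl
    rw [(List.cons.inj h).1]
  · rw [List.concat_eq_append, ← List.cons_append, ← List.append_assoc] at e
    exact hG.isPath_hist σ.1 l τ l'' (List.append_inj' e rfl).1

/-- Kuhn's argument: normalize `y` to a behavioural strategy, randomize independently at all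
information sets, and reduce the resulting pure strategies. -/
theorem PerfectRecall.exists_seqOf_eq (hG : G.PerfectRecall) (s : G.Seq i) {y : G.Seq i → ℝ}
    (hy : y ∈ G.SeqForm s) : ∃ ν ∈ stdSimplex ℝ (G.PlanTo s.1), seqOf ν = y := by
  classical
  obtain ⟨hy0, hy1, hy2⟩ := hG.mem_seqForm_iff.1 hy
  -- Where `y` has no mass, any distribution would do; the uniform one is taken.
  let b : ∀ I : G.Info i, G.Act i I → ℝ := fun I a =>
    if ∑ a, y ⟨I, a⟩ = 0 then (Fintype.card (G.Act i I) : ℝ)⁻¹ else y ⟨I, a⟩ / ∑ a, y ⟨I, a⟩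
  have hb0 : ∀ I a, 0 ≤ b I a := by
    intro I a
    simp only [b]
    split_ifs
    · positivity
    · exact div_nonneg (hy0 _) (Finset.sum_nonneg fun _ _ => hy0 _)
  have hb1 : ∀ I, ∑ a, b I a = 1 := by
    intro I
    simp only [b]
    split_ifs with h
    · simp
    · rw [← Finset.sum_div, div_self h]
  have hby : ∀ σ : G.Seq i, b σ.1 σ.2 * ∑ a, y ⟨σ.1, a⟩ = y σ := by
    intro σ
    simp only [b]
    split_ifs with h
    · rw [h, mul_zero]
      exact ((Finset.sum_eq_zero_iff_of_nonneg fun _ _ => hy0 _).1 h σ.2 (Finset.mem_univ _)).symm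
    · exact div_mul_cancel₀ _ h
  -- The conditional probabilities telescope along the history, by the flow constraints.
  have hmass : ∀ n, ∀ I : G.Info i, (hist I).length = n →
      ((hist I).map fun σ => b σ.1 σ.2).prod = ∑ a, y ⟨I, a⟩ := by
    intro n
    induction n with
    | zero =>
      intro I hI
      rw [hy1, List.length_eq_zero_iff.1 hI]
      simp
    | succ n ih =>
      intro I hI
      rcases List.eq_nil_or_concat (hist I) with h0 | ⟨l, σ, e⟩
      · simp [h0] at hI
      · rw [List.concat_eq_append] at e
        have hl : hist σ.1 = l := hG.isPath_hist I l σ [] e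
        rw [hy1, e, ← hl, List.map_append, List.prod_append, ih σ.1 (by
          rw [hl]; rw [e] at hI; simpa using hI)]
        simpa [mul_comm] using hby σ
  let P : (∀ I : G.Info i, G.Act i I) → ℝ := fun f => ∏ I, b I (f I)
  have hP0 : ∀ f, 0 ≤ P f := fun f => Finset.prod_nonneg fun I _ => hb0 I _
  have hP1 : ∑ f, P f = 1 := by
    have := sum_prod_ite_eq_prod b hb1 [] (by simp)
    simpa using this
  have hPI : ∀ I : G.Info i, (∑ f, if ∀ σ ∈ hist I, f σ.1 = σ.2 then P f else 0) =
      ∑ a, y ⟨I, a⟩ := fun I => by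
    rw [← hmass _ I rfl, ← sum_prod_ite_eq_prod b hb1 _ (hG.isPath_hist I).nodup_map_fst]
  have hPσ : ∀ σ : G.Seq i,
      (∑ f, if ∀ τ ∈ hist σ.1 ++ [σ], f τ.1 = τ.2 then P f else 0) = y σ := fun σ => by
    rw [← hby σ, ← hmass _ σ.1 rfl,
      sum_prod_ite_eq_prod b hb1 _ (hG.isPath_hist_concat σ).nodup_map_fst, List.map_append,
      List.prod_append]
    simp [mul_comm]
  -- The condition `∑ a, y ⟨s.1, a⟩ = 1` says that leading to `s.1` has probability one, so
  -- strategies not doing so have weight zero.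
  have hsupp : ∀ f, P f ≠ 0 → LeadsTo (hG.ofPure f).1 s.1 := by
    intro f hf
    rw [hG.leadsTo_iff, hG.agrees_ofPure f (hG.isPath_hist _)]
    by_contra hc
    have h1 : ∑ f, (P f - if ∀ σ ∈ hist s.1, f σ.1 = σ.2 then P f else 0) = 0 := by
      rw [Finset.sum_sub_distrib, hP1, hPI, hy2, sub_self]
    have h2 := (Finset.sum_eq_zero_iff_of_nonneg fun f _ => by
      split_ifs <;> simp [hP0 f]).1 h1 f (Finset.mem_univ _)
    rw [if_neg hc, sub_zero] at h2
    exact hf h2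
  let ν : G.PlanTo s.1 → ℝ := fun ρ => ∑ f, if hG.ofPure f = ρ.1 then P f else 0
  have hν : ∀ F : G.Plan i → ℝ, ∑ ρ, ν ρ * F ρ.1 = ∑ f, P f * F (hG.ofPure f) := by
    intro F
    simp only [ν, Finset.sum_mul]
    rw [Finset.sum_comm]
    refine Finset.sum_congr rfl fun f _ => ?_
    by_cases hf : P f = 0
    · simp [hf]
    · rw [Finset.sum_eq_single ⟨hG.ofPure f, hsupp f hf⟩]
      · simp
      · intro ρ _ hne
        rw [if_neg, zero_mul]
        intro e
        exact hne (Subtype.ext e.symm)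
      · exact fun h => absurd (Finset.mem_univ _) h
  refine ⟨ν, ⟨fun ρ => Finset.sum_nonneg fun f _ => ?_, ?_⟩, ?_⟩
  · split_ifs
    exacts [hP0 f, le_rfl]
  · simpa [hP1] using hν fun _ => 1
  · ext σ
    rw [seqOf_apply, hν fun π => if π.ToSeq σ then 1 else 0, ← hPσ σ]
    refine Finset.sum_congr rfl fun f _ => ?_
    have : (hG.ofPure f).ToSeq σ ↔ ∀ τ ∈ hist σ.1 ++ [σ], f τ.1 = τ.2 := by
      rw [← (hG.isPath_hist_concat σ).agrees_iff_toSeq hG (by simp),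
        hG.agrees_ofPure f (hG.isPath_hist_concat σ)]
    simp [this]

theorem PerfectRecall.seqForm_eq_image (hG : G.PerfectRecall) (s : G.Seq i) :
    G.SeqForm s = seqOf '' stdSimplex ℝ (G.PlanTo s.1) := by
  ext y
  constructor
  · exact hG.exists_seqOf_eq s
  · rintro ⟨ν, hν, rfl⟩
    exact hG.seqOf_mem_seqForm s hν

theorem PerfectRecall.isPolytope_seqForm (hG : G.PerfectRecall) (s : G.Seq i) :
    IsPolytope (G.SeqForm s) := by
  classical
  rw [hG.seqForm_eq_image]
  exact isPolytope_image_stdSimplex_of_eq _ _ fun ν σ => seqOf_apply ν σ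

theorem PerfectRecall.nonempty_planTo (hG : G.PerfectRecall) (I : G.Info i) :
    Nonempty (G.PlanTo I) :=
  let ⟨ρ, _⟩ := hG.exists_planTo I fun _ => Classical.arbitrary _
  ⟨ρ⟩

theorem nonempty_stdSimplex {κ : Type*} [Fintype κ] [h : Nonempty κ] :
    (stdSimplex ℝ κ).Nonempty := by
  classical
  exact ⟨_, single_mem_stdSimplex ℝ h.some⟩

theorem PerfectRecall.nonempty_seqForm (hG : G.PerfectRecall) (s : G.Seq i) :
    (G.SeqForm s).Nonempty := by
  have := hG.nonempty_planTo s.1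
  rw [hG.seqForm_eq_image]
  exact nonempty_stdSimplex.image _

theorem isPolytope_X (G : Game.{u, v}) : IsPolytope G.X := by
  classical
  exact isPolytope_image_stdSimplex_of_eq
    (fun (π : G.Profile) (x : G.XIdx) =>
      if (π x.1.1).ToSeq x.1.2 ∧ ∀ j, j ≠ x.1.1 → (π j).ToTerminal x.2 then 1 else 0) _
    fun μ x => by simp [corrPlan]

end Game

namespace Game

variable {G : Game.{u, v}} {i : Fin 2}

/-! ### Trigger agents -/

theorem triggerPlays_of_forall_notMem {s : G.Seq i} {π ρ : G.Plan i} {L : List (G.Seq i)}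
    (h : ∀ a, (⟨s.1, a⟩ : G.Seq i) ∉ L) : TriggerPlays s π ρ L ↔ Agrees π.1 L := by
  induction L with
  | nil => simp [TriggerPlays, agrees_nil]
  | cons σ l ih =>
    have hσ : σ.1 ≠ s.1 := by
      rintro e
      obtain ⟨I, a⟩ := σ
      subst e
      exact h a (by simp)
    rw [TriggerPlays, if_neg fun h' => hσ h'.1, agrees_cons,
      ih fun a ha => h a (List.mem_cons_of_mem _ ha)]

theorem triggerPlays_of_ne {s : G.Seq i} {π ρ : G.Plan i} {L : List (G.Seq i)}
    (h : π.1 s.1 ≠ some s.2) : TriggerPlays s π ρ L ↔ Agrees π.1 L := by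
  induction L with
  | nil => simp [TriggerPlays, agrees_nil]
  | cons σ l ih => rw [TriggerPlays, if_neg fun h' => h h'.2, agrees_cons, ih]

theorem triggerPlays_append {s : G.Seq i} {π ρ : G.Plan i} (h : π.1 s.1 = some s.2)
    {l l' : List (G.Seq i)} {a : G.Act i s.1} (hl : ∀ a, (⟨s.1, a⟩ : G.Seq i) ∉ l) :
    TriggerPlays s π ρ (l ++ ⟨s.1, a⟩ :: l') ↔ Agrees π.1 l ∧ Agrees ρ.1 (⟨s.1, a⟩ :: l') := by
  induction l with
  | nil => simp [TriggerPlays, h, agrees_nil]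
  | cons σ l ih =>
    have hσ : σ.1 ≠ s.1 := by
      rintro e
      obtain ⟨I, a⟩ := σ
      subst e
      exact hl a (by simp)
    rw [List.cons_append, TriggerPlays, if_neg fun h' => hσ h'.1, agrees_cons,
      ih fun a ha => hl a (List.mem_cons_of_mem _ ha), and_assoc]

/-- Both plans lead to the trigger's information set, so they agree with its history and switching
there is the same as using `ρ` throughout. -/
theorem PerfectRecall.triggerPlays_iff_of_through (hG : G.PerfectRecall) {s : G.Seq i}
    {π ρ : G.Plan i} (hρ : LeadsTo ρ.1 s.1) {L : List (G.Seq i)} (hL : IsPath L)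
    (h : ∃ a, (⟨s.1, a⟩ : G.Seq i) ∈ L) (hπ : π.ToSeq s) :
    TriggerPlays s π ρ L ↔ Agrees ρ.1 L := by
  obtain ⟨a, ha⟩ := h
  obtain ⟨l', rfl⟩ := hL.exists_split ha
  have hπ' := hG.leadsTo_iff.1 hπ.1
  have hρ' := hG.leadsTo_iff.1 hρ
  rw [triggerPlays_append hπ.2 (notMem_hist_self hG s.1), agrees_append]
  simp only [hπ', hρ']

theorem PerfectRecall.triggerPlays_iff_of_not (hG : G.PerfectRecall) {s : G.Seq i}
    {π ρ : G.Plan i} {L : List (G.Seq i)}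
    (h : ¬ ((∃ a, (⟨s.1, a⟩ : G.Seq i) ∈ L) ∧ π.ToSeq s)) :
    TriggerPlays s π ρ L ↔ Agrees π.1 L := by
  by_cases h1 : ∃ a, (⟨s.1, a⟩ : G.Seq i) ∈ L
  · exact triggerPlays_of_ne fun h2 => h ⟨h1, (hG.toSeq_iff π s).2 h2⟩
  · exact triggerPlays_of_forall_notMem fun a ha => h1 ⟨a, ha⟩

/-- Playing as a trigger agent amounts to following another plan. -/
theorem PerfectRecall.exists_plan_triggerPlays (hG : G.PerfectRecall) (s : G.Seq i)
    {ρ : G.Plan i} (hρ : LeadsTo ρ.1 s.1) (π : G.Plan i) :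
    ∃ π' : G.Plan i, ∀ L, IsPath L → (Agrees π'.1 L ↔ TriggerPlays s π ρ L) := by
  classical
  by_cases hπ : π.ToSeq s
  swap
  · exact ⟨π, fun L _ => (hG.triggerPlays_iff_of_not fun h => hπ h.2).symm⟩
  -- Switch to `ρ` at `s.1` and at all information sets after it.
  refine ⟨hG.ofPure fun J => if J = s.1 ∨ ∃ a, (⟨s.1, a⟩ : G.Seq i) ∈ hist J
    then ρ.extend J else π.extend J, fun L hL => ?_⟩
  rw [hG.agrees_ofPure _ hL]
  by_cases h : ∃ a, (⟨s.1, a⟩ : G.Seq i) ∈ L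
  · rw [hG.triggerPlays_iff_of_through hρ hL h hπ, hG.agrees_iff_extend ρ hL]
    obtain ⟨a, ha⟩ := h
    obtain ⟨l', rfl⟩ := hL.exists_split ha
    refine forall₂_congr fun σ hσ => ?_
    rcases List.mem_append.1 hσ with h1 | h1
    · rw [if_neg, (hG.agrees_iff_extend π (hG.isPath_hist _)).1 (hG.leadsTo_iff.1 hπ.1) σ h1,
        (hG.agrees_iff_extend ρ (hG.isPath_hist _)).1 (hG.leadsTo_iff.1 hρ) σ h1]
      rintro (e | ⟨b, hb⟩)
      · obtain ⟨I, b⟩ := σ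
        subst e
        exact notMem_hist_self hG s.1 b h1
      · exact notMem_hist_self hG s.1 b ((hG.isPath_hist s.1).hist_subset h1 hb)
    · rw [if_pos]
      rcases List.mem_cons.1 h1 with rfl | h2
      · exact Or.inl rfl
      · obtain ⟨l₁, l₂, rfl⟩ := List.append_of_mem h2
        refine Or.inr ⟨a, ?_⟩
        rw [hL (hist s.1 ++ ⟨s.1, a⟩ :: l₁) σ l₂ (by simp)]
        simp
  · rw [hG.triggerPlays_iff_of_not fun h' => h h'.1, hG.agrees_iff_extend π hL]
    refine forall₂_congr fun σ hσ => ?_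
    rw [if_neg]
    rintro (e | ⟨b, hb⟩)
    · obtain ⟨I, a⟩ := σ
      subst e
      exact h ⟨a, hσ⟩
    · exact h ⟨b, hL.hist_subset hσ hb⟩

/-! ### Trigger values are gains in utility -/

open Classical in
/-- The indicator of a proposition. -/
noncomputable def ind (p : Prop) : ℝ := if p then 1 else 0

theorem ind_of {p : Prop} (h : p) : ind p = 1 := by simp [ind, h]

theorem ind_of_not {p : Prop} (h : ¬ p) : ind p = 0 := by simp [ind, h]

theorem ind_and (p q : Prop) : ind (p ∧ q) = ind p * ind q := by
  by_cases hp : p <;> by_cases hq : q <;> simp [ind, hp, hq]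

theorem util_eq (i : Fin 2) (π : G.Profile) (B : List (G.Seq i) → Prop) :
    util i π B = ∑ z, ind (B (G.own i z)) *
      (ind (∀ j, j ≠ i → (π j).ToTerminal z) * (G.tree.chanceProb z * G.tree.payoff z i)) := by
  classical
  refine Finset.sum_congr rfl fun z _ => ?_
  rw [← mul_assoc, ← ind_and]
  simp [ind]

theorem util_congr {π : G.Profile} {B B' : List (G.Seq i) → Prop}
    (h : ∀ z, B (G.own i z) ↔ B' (G.own i z)) : util i π B = util i π B' := by
  rw [util_eq, util_eq]
  exact Finset.sum_congr rfl fun z _ => by rw [propext (h z)]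

theorem corrPlan_apply (μ : G.Profile → ℝ) (s : G.Seq i) (z : G.Z) :
    corrPlan μ (⟨i, s⟩, z) =
      ∑ π, μ π * (ind ((π i).ToSeq s) * ind (∀ j, j ≠ i → (π j).ToTerminal z)) := by
  refine Finset.sum_congr rfl fun π _ => ?_
  rw [← ind_and]
  simp [ind]

theorem seqOf_eq_sum_ind {I : G.Info i} (ν : G.PlanTo I → ℝ) (σ : G.Seq i) :
    seqOf ν σ = ∑ ρ, ν ρ * ind (ρ.1.ToSeq σ) := by
  simp [seqOf, ind]

/-- Shows that the default `0` in `gain` and `base` is never used, since the paths summed there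
contain an own move. -/
theorem PerfectRecall.exists_lastSeq (hG : G.PerfectRecall) {z : G.Z} {σ : G.Seq i}
    (h : σ ∈ G.own i z) :
    ∃ τ, G.lastSeq i z = some τ ∧ ∀ π : G.Plan i, Agrees π.1 (G.own i z) ↔ π.ToSeq τ :=
  have hlast := List.getLast?_eq_some_getLast (List.ne_nil_of_mem h)
  ⟨_, hlast, (hG.isPath_own z).agrees_iff_toSeq hG hlast⟩

/-- Once triggered, the paths of `ρ` through the information set replace those of `π`. The latter
contain `s` itself, as `π` prescribes its action; hence `gain` sums over paths through the
information set, but `base` only over paths through `s`. -/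
theorem PerfectRecall.ind_triggerPlays (hG : G.PerfectRecall) {s : G.Seq i} {π ρ : G.Plan i}
    (hρ : LeadsTo ρ.1 s.1) {L : List (G.Seq i)} (hL : IsPath L) :
    ind (TriggerPlays s π ρ L) =
      ind ((∃ a, (⟨s.1, a⟩ : G.Seq i) ∈ L) ∧ π.ToSeq s ∧ Agrees ρ.1 L) -
        ind (s ∈ L ∧ Agrees π.1 L) + ind (Agrees π.1 L) := by
  by_cases h : (∃ a, (⟨s.1, a⟩ : G.Seq i) ∈ L) ∧ π.ToSeq s
  · have h' : s ∈ L ∧ Agrees π.1 L ↔ Agrees π.1 L := by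
      refine and_iff_right_of_imp fun hA => ?_
      obtain ⟨a, ha⟩ := h.1
      have e : a = s.2 := Option.some.inj ((hA _ ha).symm.trans h.2.2)
      subst e
      exact ha
    rw [propext (hG.triggerPlays_iff_of_through hρ hL h.1 h.2), propext h', ← and_assoc,
      ind_and, ind_of h]
    ring
  · have h' : ¬ (s ∈ L ∧ Agrees π.1 L) := fun h' =>
      h ⟨⟨s.2, h'.1⟩, (hG.toSeq_iff _ _).2 (h'.2 s h'.1)⟩
    rw [propext (hG.triggerPlays_iff_of_not h), ← and_assoc, ind_and, ind_of_not h, ind_of_not h']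
    ring

theorem PerfectRecall.util_triggerPlays (hG : G.PerfectRecall) (s : G.Seq i) (π : G.Profile)
    {ρ : G.Plan i} (hρ : LeadsTo ρ.1 s.1) :
    util i π (TriggerPlays s (π i) ρ) =
      util i π (fun L => (∃ a, (⟨s.1, a⟩ : G.Seq i) ∈ L) ∧ (π i).ToSeq s ∧ Agrees ρ.1 L) -
        util i π (fun L => s ∈ L ∧ Agrees (π i).1 L) + util i π (Agrees (π i).1) := by
  simp only [util_eq]
  rw [← Finset.sum_sub_distrib, ← Finset.sum_add_distrib]
  refine Finset.sum_congr rfl fun z _ => ?_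
  rw [hG.ind_triggerPlays hρ (hG.isPath_own z)]
  ring

/-- The deviation plan is sampled independently of the recommendations, so the product of the
coordinates of `ξ` and `y` is a joint probability. -/
theorem PerfectRecall.gain_corrPlan_seqOf (hG : G.PerfectRecall) (s : G.Seq i)
    (μ : G.Profile → ℝ) (ν : G.PlanTo s.1 → ℝ) :
    gain s (corrPlan μ) (seqOf ν) = ∑ π, ∑ ρ, μ π * ν ρ *
      util i π (fun L => (∃ a, (⟨s.1, a⟩ : G.Seq i) ∈ L) ∧ (π i).ToSeq s ∧ Agrees ρ.1.1 L) := by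
  simp only [util_eq, Finset.mul_sum]
  simp_rw [Finset.sum_comm (s := (Finset.univ : Finset (G.PlanTo s.1)))]
  rw [gain, Finset.sum_comm (s := (Finset.univ : Finset G.Profile))]
  refine Finset.sum_congr rfl fun z _ => ?_
  split_ifs with h
  · obtain ⟨τ, hτ, hAg⟩ := hG.exists_lastSeq h.choose_spec
    rw [hτ, Option.elim_some, seqOf_eq_sum_ind, corrPlan_apply, mul_assoc, Finset.sum_mul_sum,
      Finset.mul_sum]
    refine Finset.sum_congr rfl fun π _ => ?_
    rw [Finset.mul_sum]
    refine Finset.sum_congr rfl fun ρ _ => ?_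
    rw [ind_and, ind_and, propext (hAg ρ.1), ind_of h]
    ring
  · simp [ind_and, ind_of_not h]

theorem PerfectRecall.base_corrPlan (hG : G.PerfectRecall) (s : G.Seq i) (μ : G.Profile → ℝ) :
    base s (corrPlan μ) =
      ∑ π, μ π * util i π (fun L => s ∈ L ∧ Agrees (π i).1 L) := by
  simp only [util_eq, Finset.mul_sum]
  rw [base, Finset.sum_comm (s := (Finset.univ : Finset G.Profile))]
  refine Finset.sum_congr rfl fun z _ => ?_
  split_ifs with h
  · obtain ⟨τ, hτ, hAg⟩ := hG.exists_lastSeq h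
    rw [hτ, Option.elim_some, corrPlan_apply, Finset.mul_sum]
    refine Finset.sum_congr rfl fun π _ => ?_
    rw [ind_and, propext (hAg (π i)), ind_of h]
    ring
  · simp [ind_and, ind_of_not h]

theorem PerfectRecall.triggerValue_eq (hG : G.PerfectRecall) (s : G.Seq i)
    (μ : G.Profile → ℝ) {ν : G.PlanTo s.1 → ℝ} (hν : ν ∈ stdSimplex ℝ (G.PlanTo s.1)) :
    triggerValue s (corrPlan μ) (seqOf ν) = triggerUtil i s μ ν - followUtil i μ := by
  have key : ∀ c : G.Profile → ℝ, ∑ π, ∑ ρ, μ π * ν ρ * c π = ∑ π, μ π * c π := fun c =>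
    Finset.sum_congr rfl fun π _ => by
      rw [← Finset.sum_mul, ← Finset.mul_sum, hν.2, mul_one]
  rw [triggerValue, triggerUtil, followUtil, hG.gain_corrPlan_seqOf, hG.base_corrPlan,
    ← key, ← key]
  simp only [← Finset.sum_sub_distrib]
  refine Finset.sum_congr rfl fun π _ => Finset.sum_congr rfl fun ρ _ => ?_
  rw [hG.util_triggerPlays s π ρ.2]
  ring

theorem triggerUtil_single {s : G.Seq i} [DecidableEq (G.PlanTo s.1)] (μ : G.Profile → ℝ)
    (ρ : G.PlanTo s.1) :
    triggerUtil i s μ (Pi.single ρ 1) = ∑ π, μ π * util i π (TriggerPlays s (π i) ρ.1) := by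
  refine Finset.sum_congr rfl fun π _ => ?_
  rw [Finset.sum_eq_single ρ]
  · simp
  · intro ρ' _ hne
    simp [hne]
  · simp

/-- At an information set after which the player does not move again, the trigger agent may just
follow the recommendation. -/
theorem PerfectRecall.exists_neutral_trigger (hG : G.PerfectRecall) [Nonempty (G.Info i)] :
    ∃ s : G.Seq i, ∃ ν ∈ stdSimplex ℝ (G.PlanTo s.1), ∀ μ : G.Profile → ℝ,
      triggerUtil i s μ ν = followUtil i μ := by
  classical
  -- With the longest history, no own move can follow `I`. The plan `ρ` below takes there the
  -- recommended action `a` itself.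
  obtain ⟨I, hI⟩ := Finite.exists_max fun I : G.Info i => (hist I).length
  obtain ⟨a⟩ : Nonempty (G.Act i I) := inferInstance
  obtain ⟨ρ, hρ⟩ := hG.exists_planTo I
    (Function.update (fun _ => Classical.arbitrary _) I a)
  refine ⟨⟨I, a⟩, Pi.single ρ 1, single_mem_stdSimplex ℝ ρ, fun μ => ?_⟩
  rw [triggerUtil_single, followUtil]
  refine Finset.sum_congr rfl fun π _ => congrArg _ (util_congr fun z => ?_)
  have hL := hG.isPath_own (i := i) z
  by_cases h : (∃ b, (⟨I, b⟩ : G.Seq i) ∈ G.own i z) ∧ (π i).ToSeq ⟨I, a⟩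
  swap
  · exact hG.triggerPlays_iff_of_not h
  rw [hG.triggerPlays_iff_of_through ρ.2 hL h.1 h.2]
  obtain ⟨⟨b, hb⟩, hπ⟩ := h
  obtain ⟨l', e⟩ := hL.exists_split hb
  have hl' : l' = [] := by
    rcases List.eq_nil_or_concat l' with h0 | ⟨l, σ, rfl⟩
    · exact h0
    · have h1 := hL (hist I ++ ⟨I, b⟩ :: l) σ [] (by rw [e]; simp)
      have h2 := hI σ.1
      simp [h1] at h2
  subst hl'
  dsimp only at e
  rw [e, hρ b [] (e ▸ hL), agrees_append, agrees_cons, hπ.2]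
  simp [agrees_nil, hG.leadsTo_iff.1 hπ.1]

end Game

namespace Game

variable {G : Game.{u, v}} {i : Fin 2}

/-! ### Trigger agents as strategies in the extended game -/

theorem Deviation.plays_append_iff {δ : G.Deviation i} {π : G.Plan i} {l m : List (G.Seq i)}
    (h : ∀ σ ∈ l, ∀ r, π.1 σ.1 = some r → δ.obey ⟨σ.1, r⟩ = r) :
    δ.Plays π (l ++ m) ↔ Agrees π.1 l ∧ δ.Plays π m := by
  induction l with
  | nil => simp [agrees_nil]
  | cons σ l ih =>
    rw [List.cons_append, Deviation.Plays, agrees_cons, and_assoc,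
      ← ih fun τ hτ => h τ (List.mem_cons_of_mem _ hτ)]
    constructor
    · rintro ⟨r, hr, ho, hp⟩
      have e : r = σ.2 := (h σ (by simp) r hr).symm.trans ho
      rw [if_pos e] at hp
      exact ⟨hr.trans (congrArg some e), hp⟩
    · rintro ⟨hr, hp⟩
      exact ⟨σ.2, hr, h σ (by simp) _ hr, by rwa [if_pos rfl]⟩

/-- If `g` is played both before and after the first deviation, it is irrelevant when, or whether,
`g` departs from the recommendations. -/
theorem PerfectRecall.plays_iff_of_alone (hG : G.PerfectRecall) {δ : G.Deviation i}
    {π : G.Plan i} {g : ∀ J : G.Info i, G.Act i J} (hg : ∀ σ, δ.alone σ = g)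
    {m : List (G.Seq i)} : ∀ {l : List (G.Seq i)}, IsPath (l ++ m) → Agrees π.1 l →
      (∀ σ ∈ m, ∀ r, π.1 σ.1 = some r → δ.obey ⟨σ.1, r⟩ = g σ.1) →
      (δ.Plays π m ↔ ∀ σ ∈ m, g σ.1 = σ.2) := by
  induction m with
  | nil => simp [Deviation.Plays]
  | cons σ m ih =>
    intro l hL hl ho
    have hs : (π.1 σ.1).isSome := by
      rw [hG.isSome_iff, hL l σ m rfl]
      exact hl
    obtain ⟨r, hr⟩ := Option.isSome_iff_exists.1 hs
    rw [Deviation.Plays, List.forall_mem_cons]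
    have ho' := ho σ (by simp) r hr
    have ih' : r = σ.2 → (δ.Plays π m ↔ ∀ σ ∈ m, g σ.1 = σ.2) := fun e =>
      ih (l := l ++ [σ]) (by simpa using hL)
        (agrees_append.2 ⟨hl, agrees_cons.2 ⟨hr.trans (congrArg some e), agrees_nil⟩⟩)
        fun τ hτ => ho τ (List.mem_cons_of_mem _ hτ)
    simp only [hr, Option.some.injEq, exists_eq_left', ho', hg]
    refine and_congr_right fun _ => ?_
    split_ifs with e
    · exact ih' e
    · rfl

open Classical in
/-- The strategy in the extended game of a trigger agent that deviates to the plan `ρ`. -/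
noncomputable def triggerDeviation (s : G.Seq i) (ρ : G.Plan i) : G.Deviation i where
  -- The case `s ∈ hist σ.1` is needed because `ρ` may choose the recommended action at `s.1`; no
  -- deviation has then occurred and recommendations continue.
  obey σ := if σ = s ∨ s ∈ hist σ.1 then ρ.extend σ.1 else σ.2
  alone _ := ρ.extend

theorem PerfectRecall.triggerDeviation_plays_iff (hG : G.PerfectRecall) {s : G.Seq i}
    {ρ : G.Plan i} (hρ : LeadsTo ρ.1 s.1) {π : G.Plan i} {L : List (G.Seq i)} (hL : IsPath L) :
    (triggerDeviation s ρ).Plays π L ↔ TriggerPlays s π ρ L := by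
  by_cases h : (∃ a, (⟨s.1, a⟩ : G.Seq i) ∈ L) ∧ π.ToSeq s
  · rw [hG.triggerPlays_iff_of_through hρ hL h.1 h.2]
    obtain ⟨⟨a, ha⟩, hπ⟩ := h
    obtain ⟨l', rfl⟩ := hL.exists_split ha
    have hπ' := hG.leadsTo_iff.1 hπ.1
    have hρ' := hG.leadsTo_iff.1 hρ
    dsimp only at hL ⊢
    rw [Deviation.plays_append_iff, hG.plays_iff_of_alone (g := ρ.extend) (fun _ => rfl) hL hπ',
      hG.agrees_iff_extend ρ hL, List.forall_mem_append]
    · simp only [hπ', true_and]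
      exact (and_iff_right ((hG.agrees_iff_extend ρ (hG.isPath_hist _)).1 hρ')).symm
    · intro σ hσ r hr
      refine if_pos ?_
      rcases List.mem_cons.1 hσ with rfl | h2
      · exact Or.inl (Sigma.ext rfl (heq_of_eq (Option.some.inj (hr.symm.trans hπ.2))))
      · obtain ⟨l₁, l₂, rfl⟩ := List.append_of_mem h2
        have h3 := hL (hist s.1 ++ ⟨s.1, a⟩ :: l₁) σ l₂ (by simp)
        have h4 := hG.agrees_hist_of_eq_some π hr
        rw [h3] at h4
        have h5 : a = s.2 := Option.some.inj ((h4 ⟨s.1, a⟩ (by simp)).symm.trans hπ.2)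
        subst h5
        exact Or.inr (by rw [h3]; simp)
    · intro σ hσ r hr
      refine if_neg ?_
      rintro (e | hs)
      · obtain ⟨I, b⟩ := σ
        subst e
        exact notMem_hist_self hG _ b hσ
      · exact notMem_hist_self hG s.1 s.2 ((hG.isPath_hist s.1).hist_subset hσ hs)
  · rw [hG.triggerPlays_iff_of_not h]
    have := Deviation.plays_append_iff (δ := triggerDeviation s ρ) (π := π) (l := L) (m := []) ?_
    · simpa [Deviation.Plays] using this
    · intro σ hσ r hr
      refine if_neg ?_
      rintro (e | hs)
      · subst e
        exact h ⟨⟨σ.2, hσ⟩, (hG.toSeq_iff _ _).2 hr⟩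
      · exact h ⟨⟨s.2, hL.hist_subset hσ hs⟩,
          (hG.toSeq_iff _ _).2 (hG.agrees_hist_of_eq_some π hr s hs)⟩

theorem PerfectRecall.triggerUtil_le_of_isEFCE (hG : G.PerfectRecall) {μ : G.Profile → ℝ}
    (hμ : IsEFCE μ) (s : G.Seq i) {ν : G.PlanTo s.1 → ℝ}
    (hν : ν ∈ stdSimplex ℝ (G.PlanTo s.1)) : triggerUtil i s μ ν ≤ followUtil i μ := by
  calc triggerUtil i s μ ν
      = ∑ ρ, ν ρ * ∑ π, μ π * util i π ((triggerDeviation s ρ.1).Plays (π i)) := by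
        rw [triggerUtil, Finset.sum_comm]
        refine Finset.sum_congr rfl fun ρ _ => ?_
        rw [Finset.mul_sum]
        refine Finset.sum_congr rfl fun π _ => ?_
        rw [util_congr fun z => hG.triggerDeviation_plays_iff ρ.2 (hG.isPath_own z)]
        ring
    _ ≤ ∑ ρ, ν ρ * followUtil i μ :=
        Finset.sum_le_sum fun ρ _ => mul_le_mul_of_nonneg_left (hμ i _) (hν.1 ρ)
    _ = followUtil i μ := by rw [← Finset.sum_mul, hν.2, one_mul]

/-! ### Strategies in the extended game decompose into trigger agents -/

theorem IsPath.trichotomy {L : List (G.Seq i)} (hL : IsPath L) {σ τ : G.Seq i} (hσ : σ ∈ L)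
    (hτ : τ ∈ L) : σ = τ ∨ σ ∈ hist τ.1 ∨ τ ∈ hist σ.1 := by
  obtain ⟨l₁, rfl⟩ := hL.exists_split hσ
  rcases List.mem_append.1 hτ with h | h
  · exact Or.inr (Or.inr h)
  rcases List.mem_cons.1 h with rfl | h
  · exact Or.inl rfl
  obtain ⟨m₁, m₂, rfl⟩ := List.append_of_mem h
  rw [hL (hist σ.1 ++ σ :: m₁) τ m₂ (by simp)]
  simp

theorem sum_ind_eq_ind_exists {κ : Type*} [Fintype κ] {P : κ → Prop}
    (h : ∀ k k', P k → P k' → k = k') : ∑ k, ind (P k) = ind (∃ k, P k) := by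
  by_cases hP : ∃ k, P k
  · obtain ⟨k, hk⟩ := hP
    rw [ind_of ⟨k, hk⟩, Finset.sum_eq_single k, ind_of hk]
    · exact fun k' _ hne => ind_of_not fun hk' => hne (h _ _ hk' hk)
    · exact fun h => absurd (Finset.mem_univ _) h
  · rw [ind_of_not hP]
    exact Finset.sum_eq_zero fun k _ => ind_of_not fun hk => hP ⟨k, hk⟩

/-- The strategy `δ` may deviate for the first time on the recommendation `σ`. -/
def Deviation.IsFirst (δ : G.Deviation i) (σ : G.Seq i) : Prop :=
  δ.obey σ ≠ σ.2 ∧ ∀ τ ∈ hist σ.1, δ.obey τ = τ.2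

/-- When `π` is recommended and `δ` is used, the first deviation on the path `L` takes place on
the recommendation `σ`. -/
def Deviation.DeviatesAt (δ : G.Deviation i) (π : G.Plan i) (L : List (G.Seq i))
    (σ : G.Seq i) : Prop :=
  δ.IsFirst σ ∧ π.1 σ.1 = some σ.2 ∧ ∃ l', L = hist σ.1 ++ ⟨σ.1, δ.obey σ⟩ :: l' ∧
    ∀ τ ∈ l', δ.alone σ τ.1 = τ.2

/-- Induction along the path, where `l` is the part travelled obediently: either `δ` obeys to the
end or there is a first deviation. -/
theorem PerfectRecall.plays_iff (hG : G.PerfectRecall) (δ : G.Deviation i) (π : G.Plan i)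
    {m : List (G.Seq i)} : ∀ {l : List (G.Seq i)}, IsPath (l ++ m) → Agrees π.1 l →
      (∀ σ ∈ l, δ.obey σ = σ.2) →
      (δ.Plays π m ↔ (Agrees π.1 (l ++ m) ∧ ∀ σ ∈ l ++ m, δ.obey σ = σ.2) ∨
        ∃ σ, δ.DeviatesAt π (l ++ m) σ) := by
  induction m with
  | nil =>
    intro l hL hl ho
    simp only [Deviation.Plays, List.append_nil, true_iff]
    exact Or.inl ⟨hl, ho⟩
  | cons σ m ih =>
    intro l hL hl ho
    have hσ : hist σ.1 = l := hL l σ m rfl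
    have hs : (π.1 σ.1).isSome := by
      rw [hG.isSome_iff, hσ]
      exact hl
    obtain ⟨r, hr⟩ := Option.isSome_iff_exists.1 hs
    have e0 : l ++ σ :: m = l ++ [σ] ++ m := by simp
    rw [Deviation.Plays]
    simp only [hr, Option.some.injEq, exists_eq_left']
    constructor
    · rintro ⟨h1, h2⟩
      split_ifs at h2 with e
      · rw [e0] at hL ⊢
        refine (ih hL (agrees_append.2 ⟨hl, agrees_cons.2 ⟨hr.trans (congrArg some e),
          agrees_nil⟩⟩) fun τ hτ => ?_).1 h2
        rcases List.mem_append.1 hτ with h | h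
        · exact ho τ h
        · rw [List.mem_singleton.1 h]
          rw [e] at h1
          exact h1
      · refine Or.inr ⟨⟨σ.1, r⟩, ⟨fun h => e (h.symm.trans h1), hσ ▸ ho⟩, hr, m, ?_, h2⟩
        rw [h1, hσ]
    · intro h
      by_cases e : r = σ.2 ∧ δ.obey σ = σ.2
      · obtain ⟨e, h1⟩ := e
        rw [if_pos e, e]
        refine ⟨h1, ?_⟩
        rw [e0] at hL h
        refine (ih hL (agrees_append.2 ⟨hl, agrees_cons.2 ⟨hr.trans (congrArg some e),
          agrees_nil⟩⟩) fun τ hτ => ?_).2 h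
        rcases List.mem_append.1 hτ with h | h
        · exact ho τ h
        · rwa [List.mem_singleton.1 h]
      · rcases h with ⟨h1, h2⟩ | ⟨τ, ⟨hτ1, hτ2⟩, hτr, l', e1, hal⟩
        · exact absurd ⟨Option.some.inj (hr.symm.trans (h1 σ (by simp))), h2 σ (by simp)⟩ e
        have hmem : (⟨τ.1, δ.obey τ⟩ : G.Seq i) ∈ l ++ σ :: m := by rw [e1]; simp
        -- The deviating move is either at `σ`, or later, contradicting `e`, or inside `l`, where
        -- the recommendations were followed.
        rcases hL.trichotomy (σ := σ) (by simp) hmem with h | h | h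
        · obtain ⟨I, b⟩ := σ
          obtain ⟨J, c⟩ := τ
          obtain ⟨e₂, h⟩ := Sigma.mk.inj_iff.1 h
          dsimp only at e₂ hσ e1 hr hτr
          subst e₂
          obtain rfl : r = c := Option.some.inj (hr.symm.trans hτr)
          have h := eq_of_heq h
          refine ⟨h.symm, ?_⟩
          rw [if_neg fun e₃ => hτ1 (h.symm.trans e₃.symm)]
          rw [hσ] at e1
          rw [(List.cons.inj (List.append_cancel_left e1)).2]
          exact hal
        · exact absurd ⟨Option.some.inj (hr.symm.trans (hG.agrees_hist_of_eq_some π hτr σ h)),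
            hτ2 σ h⟩ e
        · rw [hσ] at h
          exact absurd (Option.some.inj ((hl _ h).symm.trans hτr)) hτ1

/-- The later of two deviations would need a recommendation, and `π` only prescribes actions
consistent with its own earlier moves, among them the earlier deviating move. -/
theorem PerfectRecall.deviatesAt_unique (hG : G.PerfectRecall) {δ : G.Deviation i} {π : G.Plan i}
    {L : List (G.Seq i)} (hL : IsPath L) {σ τ : G.Seq i} (hσ : δ.DeviatesAt π L σ)
    (hτ : δ.DeviatesAt π L τ) : σ = τ := by
  obtain ⟨⟨hσ1, -⟩, hσr, l₁, e₁, -⟩ := hσ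
  obtain ⟨⟨hτ1, -⟩, hτr, l₂, e₂, -⟩ := hτ
  rcases hL.trichotomy (σ := ⟨σ.1, δ.obey σ⟩) (τ := ⟨τ.1, δ.obey τ⟩) (by rw [e₁]; simp)
    (by rw [e₂]; simp) with h | h | h
  · have h1 : σ.1 = τ.1 := (Sigma.mk.inj_iff.1 h).1
    obtain ⟨I, a⟩ := σ
    obtain ⟨J, b⟩ := τ
    dsimp only at h1
    subst h1
    exact Sigma.ext rfl (heq_of_eq (Option.some.inj (hσr.symm.trans hτr)))
  · exact absurd (Option.some.inj ((hG.agrees_hist_of_eq_some π hτr _ h).symm.trans hσr)) hσ1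
  · exact absurd (Option.some.inj ((hG.agrees_hist_of_eq_some π hσr _ h).symm.trans hτr)) hτ1

theorem IsPath.exists_isFirst {δ : G.Deviation i} {L : List (G.Seq i)} (hL : IsPath L)
    (hG : G.PerfectRecall) :
    (∃ σ, δ.IsFirst σ ∧ σ ∈ L) ↔ ¬ ∀ σ ∈ L, δ.obey σ = σ.2 := by
  constructor
  · rintro ⟨σ, hσ, hσL⟩ h
    exact hσ.1 (h σ hσL)
  · intro h
    push Not at h
    have key : ∀ n, ∀ σ ∈ L, δ.obey σ ≠ σ.2 → (hist σ.1).length ≤ n →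
        ∃ σ, δ.IsFirst σ ∧ σ ∈ L := by
      intro n
      induction n with
      | zero =>
        intro σ hσ hne hn
        refine ⟨σ, ⟨hne, ?_⟩, hσ⟩
        rw [List.length_eq_zero_iff.1 (Nat.le_zero.1 hn)]
        simp
      | succ n ih =>
        intro σ hσ hne hn
        by_cases hf : ∀ τ ∈ hist σ.1, δ.obey τ = τ.2
        · exact ⟨σ, ⟨hne, hf⟩, hσ⟩
        · push Not at hf
          obtain ⟨τ, hτ, hτne⟩ := hf
          refine ih τ (hL.hist_subset hσ hτ) hτne ?_
          obtain ⟨l', e⟩ := (hG.isPath_hist σ.1).exists_split hτ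
          have := congrArg List.length e
          simp at this
          lia
    obtain ⟨σ, hσ, hne⟩ := h
    exact key _ σ hσ hne le_rfl

theorem IsPath.isFirst_unique {δ : G.Deviation i} {L : List (G.Seq i)} (hL : IsPath L)
    {σ τ : G.Seq i} (hσ : δ.IsFirst σ ∧ σ ∈ L) (hτ : δ.IsFirst τ ∧ τ ∈ L) : σ = τ := by
  rcases hL.trichotomy hσ.2 hτ.2 with h | h | h
  · exact h
  · exact absurd (hτ.1.2 σ h) hσ.1.1
  · exact absurd (hσ.1.2 τ h) hτ.1.1

/-- Turns a first deviation of `δ` at `σ` into a trigger agent: the plan leads to `σ.1`, takes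
`δ.obey σ` there and follows `δ.alone σ` afterwards. -/
theorem PerfectRecall.exists_planTo_deviatesAt (hG : G.PerfectRecall) (δ : G.Deviation i)
    (σ : G.Seq i) : ∃ ρ : G.PlanTo σ.1, ∀ (π : G.Plan i) (L : List (G.Seq i)), IsPath L →
      δ.IsFirst σ → (((∃ a, (⟨σ.1, a⟩ : G.Seq i) ∈ L) ∧ π.ToSeq σ ∧ Agrees ρ.1.1 L) ↔
        δ.DeviatesAt π L σ) := by
  classical
  obtain ⟨ρ, hρ⟩ := hG.exists_planTo σ.1 (Function.update (δ.alone σ) σ.1 (δ.obey σ))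
  have key : ∀ a l', IsPath (hist σ.1 ++ ⟨σ.1, a⟩ :: l') →
      (Agrees ρ.1.1 (hist σ.1 ++ ⟨σ.1, a⟩ :: l') ↔
        δ.obey σ = a ∧ ∀ τ ∈ l', δ.alone σ τ.1 = τ.2) := by
    intro a l' hp
    rw [hρ a l' hp, List.forall_mem_cons, Function.update_self]
    refine and_congr_right fun _ => forall₂_congr fun τ hτ => ?_
    rw [Function.update_of_ne]
    intro e
    have h1 := hp.eq_of_fst_eq (σ := τ) (τ := ⟨σ.1, a⟩)
      (List.mem_append_right _ (List.mem_cons_of_mem _ hτ)) (by simp) e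
    obtain ⟨l₁, l₂, rfl⟩ := List.append_of_mem hτ
    have h2 := hp (hist σ.1 ++ ⟨σ.1, a⟩ :: l₁) τ l₂ (by simp)
    rw [h1] at h2
    have := congrArg List.length h2
    simp at this
  refine ⟨ρ, fun π L hL hf => ?_⟩
  constructor
  · rintro ⟨⟨a, ha⟩, hπ, hA⟩
    obtain ⟨l', rfl⟩ := hL.exists_split ha
    obtain ⟨rfl, h2⟩ := (key a l' hL).1 hA
    exact ⟨hf, hπ.2, l', rfl, h2⟩
  · rintro ⟨-, hr, l', rfl, h2⟩
    exact ⟨⟨δ.obey σ, by simp⟩, (hG.toSeq_iff _ _).2 hr, (key _ l' hL).2 ⟨rfl, h2⟩⟩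

theorem ind_and_or {p q r : Prop} (h : r → ¬ p) :
    ind (p ∧ q ∨ r) = ind p + (ind r - ind (¬ q) * ind p) := by
  by_cases hp : p <;> by_cases hq : q <;> by_cases hr : r <;> simp_all [ind]

/-- A path of `π` is lost exactly when it contains a disobeyed sequence, and then it contains a
unique first one; a path is gained exactly when it has a first deviation, also unique. So both
corrections are sums over `σ`, matching `ind_triggerPlays` term by term. -/
theorem PerfectRecall.ind_plays (hG : G.PerfectRecall) (δ : G.Deviation i) (π : G.Plan i)
    {L : List (G.Seq i)} (hL : IsPath L) :
    ind (δ.Plays π L) = ind (Agrees π.1 L) +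
      ∑ σ, (ind (δ.DeviatesAt π L σ) - ind ((δ.IsFirst σ ∧ σ ∈ L) ∧ Agrees π.1 L)) := by
  have h0 := hG.plays_iff δ π (l := []) (m := L) hL agrees_nil (by simp)
  rw [List.nil_append] at h0
  rw [Finset.sum_sub_distrib, sum_ind_eq_ind_exists fun σ τ => hG.deviatesAt_unique hL]
  have h3 : ∑ σ, ind ((δ.IsFirst σ ∧ σ ∈ L) ∧ Agrees π.1 L) =
      (∑ σ, ind (δ.IsFirst σ ∧ σ ∈ L)) * ind (Agrees π.1 L) := by
    rw [Finset.sum_mul]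
    exact Finset.sum_congr rfl fun σ _ => ind_and _ _
  rw [h3, sum_ind_eq_ind_exists fun σ τ => hL.isFirst_unique, propext (hL.exists_isFirst hG),
    propext h0]
  refine ind_and_or fun h1 hA => ?_
  obtain ⟨σ, hf, hr, l', rfl, -⟩ := h1
  exact hf.1 (Option.some.inj ((hA ⟨σ.1, δ.obey σ⟩ (by simp)).symm.trans hr))

theorem PerfectRecall.isEFCE_of_triggerUtil_le (hG : G.PerfectRecall) {μ : G.Profile → ℝ}
    (h : ∀ (i : Fin 2) (s : G.Seq i), ∀ ν ∈ stdSimplex ℝ (G.PlanTo s.1),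
      triggerUtil i s μ ν ≤ followUtil i μ) : IsEFCE μ := by
  classical
  intro i δ
  choose ρ hρ using hG.exists_planTo_deviatesAt δ
  have hutil : ∀ π : G.Profile, util i π (δ.Plays (π i)) = util i π (Agrees (π i).1) +
      ∑ σ, ind (δ.IsFirst σ) *
        (util i π (TriggerPlays σ (π i) (ρ σ).1) - util i π (Agrees (π i).1)) := by
    intro π
    simp only [util_eq, ← Finset.sum_sub_distrib, Finset.mul_sum]
    rw [Finset.sum_comm, ← Finset.sum_add_distrib]
    refine Finset.sum_congr rfl fun z _ => ?_
    have hL := hG.isPath_own (i := i) z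
    rw [hG.ind_plays δ (π i) hL, add_mul, Finset.sum_mul]
    congr 1
    refine Finset.sum_congr rfl fun σ _ => ?_
    rw [hG.ind_triggerPlays (ρ σ).2 hL]
    by_cases hf : δ.IsFirst σ
    · rw [propext (hρ σ (π i) _ hL hf), ind_of hf]
      simp only [hf, true_and]
      ring
    · rw [ind_of_not hf, ind_of_not (p := δ.DeviatesAt _ _ _) fun h' => hf h'.1,
        ind_of_not (p := (_ ∧ _) ∧ _) fun h' => hf h'.1.1]
      ring
  have hsum : ∑ π, μ π * util i π (δ.Plays (π i)) = followUtil i μ +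
      ∑ σ, ind (δ.IsFirst σ) * (triggerUtil i σ μ (Pi.single (ρ σ) 1) - followUtil i μ) := by
    simp only [hutil, triggerUtil_single, followUtil, mul_add, Finset.sum_add_distrib,
      ← Finset.sum_sub_distrib, Finset.mul_sum]
    congr 1
    rw [Finset.sum_comm]
    exact Finset.sum_congr rfl fun _ _ => Finset.sum_congr rfl fun _ _ => by ring
  rw [hsum]
  refine add_le_of_nonpos_right (Finset.sum_nonpos fun σ _ => ?_)
  refine mul_nonpos_of_nonneg_of_nonpos ?_
    (sub_nonpos.2 (h i σ _ (single_mem_stdSimplex ℝ (ρ σ))))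
  unfold ind
  split_ifs <;> norm_num

theorem PerfectRecall.isEFCE_iff_triggerUtil_le (hG : G.PerfectRecall) (μ : G.Profile → ℝ) :
    IsEFCE μ ↔ ∀ (i : Fin 2) (s : G.Seq i), ∀ ν ∈ stdSimplex ℝ (G.PlanTo s.1),
      triggerUtil i s μ ν ≤ followUtil i μ :=
  ⟨fun h _ s _ hν => hG.triggerUtil_le_of_isEFCE h s hν, hG.isEFCE_of_triggerUtil_le⟩

end Game

namespace Game

variable {G : Game.{u, v}} {i : Fin 2}

/-! ### Existence -/

theorem util_congr_of_ne {π π' : G.Profile} {B B' : List (G.Seq i) → Prop}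
    (hπ : ∀ j, j ≠ i → π j = π' j) (h : ∀ z, B (G.own i z) ↔ B' (G.own i z)) :
    util i π B = util i π' B' := by
  rw [util_congr h, util_eq, util_eq]
  refine Finset.sum_congr rfl fun z _ => ?_
  have : (∀ j, j ≠ i → (π j).ToTerminal z) ↔ ∀ j, j ≠ i → (π' j).ToTerminal z :=
    forall₂_congr fun j hj => by rw [hπ j hj]
  rw [propext this]

/-- Isolates the coordinate of one player, whose plan is independent of the others under a product
distribution. -/
theorem sum_prod_mul_eq {ι : Type*} [Fintype ι] [DecidableEq ι] {κ : ι → Type*}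
    [∀ j, Fintype (κ j)] (x : ∀ j, κ j → ℝ) (F : (∀ j, κ j) → ℝ) (i : ι) :
    ∑ π, (∏ j, x j (π j)) * F π = ∑ q : ∀ j : {j // j ≠ i}, κ j, (∏ j : {j // j ≠ i}, x j (q j)) *
      ∑ k : κ i, x i k * F ((Equiv.piSplitAt i κ).symm (k, q)) := by
  rw [← Equiv.sum_comp (Equiv.piSplitAt i κ).symm, Fintype.sum_prod_type, Finset.sum_comm]
  refine Finset.sum_congr rfl fun q _ => ?_
  rw [Finset.mul_sum]
  refine Finset.sum_congr rfl fun k _ => ?_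
  rw [← Finset.mul_prod_erase _ _ (Finset.mem_univ i),
    Finset.prod_subtype (p := fun j => j ≠ i) _ (by simp)]
  have h1 : (Equiv.piSplitAt i κ).symm (k, q) i = k := by simp [Equiv.piSplitAt]
  have h2 : ∀ j : {j // j ≠ i}, (Equiv.piSplitAt i κ).symm (k, q) j = q j := fun j => by
    simp [Equiv.piSplitAt, j.2]
  simp only [h1, h2]
  ring

theorem prod_mem_stdSimplex {ι : Type*} [Fintype ι] [DecidableEq ι] {κ : ι → Type*}
    [∀ j, Fintype (κ j)] {x : ∀ j, κ j → ℝ} (hx : ∀ j, x j ∈ stdSimplex ℝ (κ j)) :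
    (fun π : ∀ j, κ j => ∏ j, x j (π j)) ∈ stdSimplex ℝ (∀ j, κ j) := by
  refine ⟨fun π => Finset.prod_nonneg fun j _ => (hx j).1 _, ?_⟩
  have := Finset.prod_univ_sum (fun j => (Finset.univ : Finset (κ j))) fun j a => x j a
  rw [Fintype.piFinset_univ] at this
  rw [← this]
  exact Finset.prod_eq_one fun j _ => (hx j).2

theorem PerfectRecall.exists_isEFCE (hG : G.PerfectRecall) : ∃ μ ∈ G.CorrDist, IsEFCE μ := by
  classical
  have hne : ∀ i, Nonempty (G.Plan i) := fun i => ⟨hG.ofPure fun _ => Classical.arbitrary _⟩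
  choose φ hφ using fun (i : Fin 2) (t : Σ s : G.Seq i, G.PlanTo s.1) (π : G.Plan i) =>
    hG.exists_plan_triggerPlays t.1 t.2.2 π
  let D : ∀ i, (Σ s : G.Seq i, G.PlanTo s.1) → G.Profile → ℝ := fun i t π =>
    util i π (TriggerPlays t.1 (π i) t.2.1) - util i π (Agrees (π i).1)
  -- By minimax, it suffices to find for each mixture `c` of trigger agents of both players a
  -- distribution against which the mixture gains nothing.
  obtain ⟨μ, hμ, hle⟩ := exists_mem_stdSimplex_forall_sum_nonpos
    (fun (π : G.Profile) (t : Σ i, Σ s : G.Seq i, G.PlanTo s.1) => D t.1 t.2 π) fun c hc => by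
    choose x hx hst using fun i => exists_stationary (φ i) (c := fun t => c ⟨i, t⟩)
      fun t => hc.1 _
    refine ⟨_, prod_mem_stdSimplex hx, le_of_eq ?_⟩
    calc _ = ∑ i, ∑ t, c ⟨i, t⟩ * ∑ π : G.Profile, (∏ j, x j (π j)) * D i t π := by
          simp only [Finset.mul_sum]
          rw [Finset.sum_comm, Fintype.sum_sigma]
          exact Finset.sum_congr rfl fun _ _ => Finset.sum_congr rfl fun _ _ =>
            Finset.sum_congr rfl fun _ _ => by ring
      _ = 0 := Finset.sum_eq_zero fun i _ => ?_
    let E := (Equiv.piSplitAt i G.Plan).symm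
    have hE : ∀ k q, E (k, q) i = k := fun k q => by simp [E, Equiv.piSplitAt]
    have hE' : ∀ k k' q j, j ≠ i → E (k, q) j = E (k', q) j := fun k k' q j hj => by
      simp [E, Equiv.piSplitAt, hj]
    -- With the other player's plan fixed by `q`, the gain is the increment of one function of the
    -- own plan along `φ i t`, so it averages to zero under the stationary `x i`.
    have hD : ∀ t k q, D i t (E (k, q)) = util i (E (φ i t k, q)) (Agrees (E (φ i t k, q) i).1) -
        util i (E (k, q)) (Agrees (E (k, q) i).1) := by
      intro t k q
      simp only [D]
      congr 1
      refine util_congr_of_ne (hE' _ _ q) fun z => ?_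
      rw [hE, hE]
      exact (hφ i t k _ (hG.isPath_own z)).symm
    simp only [sum_prod_mul_eq x _ i]
    calc _ = ∑ q : ∀ j : {j // j ≠ i}, G.Plan j, (∏ j : {j // j ≠ i}, x j (q j)) *
          ∑ t, c ⟨i, t⟩ * ∑ k, x i k * D i t (E (k, q)) := by
          simp only [Finset.mul_sum]
          rw [Finset.sum_comm]
          exact Finset.sum_congr rfl fun _ _ => Finset.sum_congr rfl fun _ _ =>
            Finset.sum_congr rfl fun _ _ => by simp only [E]; ring
      _ = 0 := Finset.sum_eq_zero fun q _ => by
          simp only [hD]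
          rw [hst i fun k => util i (E (k, q)) (Agrees (E (k, q) i).1), mul_zero]
  refine ⟨μ, hμ, hG.isEFCE_of_triggerUtil_le fun i s ν hν => ?_⟩
  have h1 : triggerUtil i s μ ν - followUtil i μ = ∑ ρ, ν ρ * ∑ π, μ π * D i ⟨s, ρ⟩ π := by
    have key : followUtil i μ = ∑ ρ, ν ρ * followUtil i μ := by
      rw [← Finset.sum_mul, hν.2, one_mul]
    rw [key, triggerUtil, followUtil, Finset.sum_comm, ← Finset.sum_sub_distrib]
    refine Finset.sum_congr rfl fun ρ _ => ?_
    rw [Finset.mul_sum, Finset.mul_sum, ← Finset.sum_sub_distrib]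
    exact Finset.sum_congr rfl fun π _ => by simp only [D]; ring
  rw [← sub_nonpos, h1]
  exact Finset.sum_nonpos fun ρ _ =>
    mul_nonpos_of_nonneg_of_nonpos (hν.1 ρ) (hle ⟨i, s, ρ⟩)

end Game

/-- The bilinear case with a one-dimensional second argument. -/
theorem exists_dotProduct_eq {m : Type*} [Fintype m] (B : (m → ℝ) → ℝ)
    (h₁ : ∀ x x', B (x + x') = B x + B x') (h₂ : ∀ (c : ℝ) x, B (c • x) = c * B x) :
    ∃ b : m → ℝ, ∀ x, B x = b ⬝ᵥ x := by
  obtain ⟨M, hM⟩ := exists_dotProduct_mulVec_eq (fun x (y : Unit → ℝ) => B x * y ())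
    (by simp [h₁, add_mul]) (by simp [h₂, mul_assoc]) (by simp [mul_add])
    (by simp [mul_left_comm])
  refine ⟨M *ᵥ fun _ => 1, fun x => ?_⟩
  have := hM x fun _ => 1
  rw [dotProduct_comm]
  simpa using this

namespace Game

variable {G : Game.{u, v}} {i : Fin 2}

/-! ### The saddle-point problem -/

theorem gain_add_left (s : G.Seq i) (ξ ξ' : G.XIdx → ℝ) (y : G.Seq i → ℝ) :
    gain s (ξ + ξ') y = gain s ξ y + gain s ξ' y := by
  simp only [gain]
  rw [← Finset.sum_add_distrib]
  refine Finset.sum_congr rfl fun z _ => ?_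
  split_ifs
  · rw [Pi.add_apply]
    ring
  · simp

theorem gain_smul_left (s : G.Seq i) (c : ℝ) (ξ : G.XIdx → ℝ) (y : G.Seq i → ℝ) :
    gain s (c • ξ) y = c * gain s ξ y := by
  simp only [gain]
  rw [Finset.mul_sum]
  refine Finset.sum_congr rfl fun z _ => ?_
  split_ifs
  · rw [Pi.smul_apply, smul_eq_mul]
    ring
  · simp

theorem gain_add_right (s : G.Seq i) (ξ : G.XIdx → ℝ) (y y' : G.Seq i → ℝ) :
    gain s ξ (y + y') = gain s ξ y + gain s ξ y' := by
  simp only [gain]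
  rw [← Finset.sum_add_distrib]
  refine Finset.sum_congr rfl fun z _ => ?_
  split_ifs
  · cases G.lastSeq i z <;> simp [mul_add]
  · simp

theorem gain_smul_right (s : G.Seq i) (c : ℝ) (ξ : G.XIdx → ℝ) (y : G.Seq i → ℝ) :
    gain s ξ (c • y) = c * gain s ξ y := by
  simp only [gain]
  rw [Finset.mul_sum]
  refine Finset.sum_congr rfl fun z _ => ?_
  split_ifs
  · cases G.lastSeq i z <;> simp [mul_left_comm]
  · simp

theorem base_add (s : G.Seq i) (ξ ξ' : G.XIdx → ℝ) :
    base s (ξ + ξ') = base s ξ + base s ξ' := by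
  simp only [base]
  rw [← Finset.sum_add_distrib]
  refine Finset.sum_congr rfl fun z _ => ?_
  split_ifs
  · cases G.lastSeq i z <;> simp [mul_add]
  · simp

theorem base_smul (s : G.Seq i) (c : ℝ) (ξ : G.XIdx → ℝ) : base s (c • ξ) = c * base s ξ := by
  simp only [base]
  rw [Finset.mul_sum]
  refine Finset.sum_congr rfl fun z _ => ?_
  split_ifs
  · cases G.lastSeq i z <;> simp [mul_left_comm]
  · simp

open Classical in
/-- A vector indexed by the coordinates of player `i`, extended by zero. -/
noncomputable def extendCoord (i : Fin 2) (x : G.Seq i × G.Z → ℝ) : G.XIdx → ℝ := fun p =>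
  if h : p.1.1 = i then x (h ▸ p.1.2, p.2) else 0

theorem extendCoord_apply (x : G.Seq i × G.Z → ℝ) (σ : G.Seq i) (z : G.Z) :
    extendCoord i x (⟨i, σ⟩, z) = x (σ, z) := by
  simp [extendCoord]

theorem extendCoord_add (x x' : G.Seq i × G.Z → ℝ) :
    extendCoord i (x + x') = extendCoord i x + extendCoord i x' := by
  ext p
  simp only [extendCoord, Pi.add_apply]
  split_ifs <;> simp

theorem extendCoord_smul (c : ℝ) (x : G.Seq i × G.Z → ℝ) :
    extendCoord i (c • x) = c • extendCoord i x := by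
  ext p
  simp only [extendCoord, Pi.smul_apply]
  split_ifs <;> simp

theorem gain_extendCoord (s : G.Seq i) (ξ : G.XIdx → ℝ) (y : G.Seq i → ℝ) :
    gain s (extendCoord i fun x => ξ (⟨i, x.1⟩, x.2)) y = gain s ξ y := by
  simp only [gain, extendCoord_apply]

theorem base_extendCoord (s : G.Seq i) (ξ : G.XIdx → ℝ) :
    base s (extendCoord i fun x => ξ (⟨i, x.1⟩, x.2)) = base s ξ := by
  simp only [base, extendCoord_apply]

theorem exists_matrix_gain_base (s : G.Seq i) :
    ∃ (A : Matrix (G.Seq i × G.Z) (G.Seq i) ℝ) (b : G.Seq i × G.Z → ℝ),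
      ∀ (ξ : G.XIdx → ℝ) (y : G.Seq i → ℝ),
        gain s ξ y = (fun x => ξ (⟨i, x.1⟩, x.2)) ⬝ᵥ (A *ᵥ y) ∧
        base s ξ = b ⬝ᵥ (fun x => ξ (⟨i, x.1⟩, x.2)) := by
  -- `gain` and `base` read only the coordinates of player `i`, so extension by zero loses nothing.
  obtain ⟨A, hA⟩ := exists_dotProduct_mulVec_eq (fun x y => gain s (extendCoord i x) y)
    (fun x x' y => by rw [extendCoord_add, gain_add_left])
    (fun c x y => by rw [extendCoord_smul, gain_smul_left])
    (fun x y y' => gain_add_right _ _ _ _) (fun c x y => gain_smul_right _ _ _ _)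
  obtain ⟨b, hb⟩ := exists_dotProduct_eq (fun x => base s (extendCoord i x))
    (fun x x' => by rw [extendCoord_add, base_add])
    (fun c x => by rw [extendCoord_smul, base_smul])
  exact ⟨A, b, fun ξ y => ⟨by rw [← hA, gain_extendCoord], by rw [← hb, base_extendCoord]⟩⟩

theorem exists_matrix_objective (G : Game.{u, v}) :
    ∃ M : Matrix G.XIdx G.YIdx ℝ, ∀ ξ w, objective ξ w = ξ ⬝ᵥ (M *ᵥ w) := by
  refine exists_dotProduct_mulVec_eq _ (fun ξ ξ' w => ?_) (fun c ξ w => ?_) (fun ξ w w' => ?_)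
    (fun c ξ w => ?_)
  · simp only [objective, ← Finset.sum_add_distrib]
    refine Finset.sum_congr rfl fun i _ => Finset.sum_congr rfl fun s _ => ?_
    rw [gain_add_left, base_add]
    ring
  · simp only [objective, Finset.mul_sum]
    refine Finset.sum_congr rfl fun i _ => Finset.sum_congr rfl fun s _ => ?_
    rw [gain_smul_left, base_smul]
    ring
  · simp only [objective, ← Finset.sum_add_distrib]
    refine Finset.sum_congr rfl fun i _ => Finset.sum_congr rfl fun s _ => ?_
    have h1 : zvec (w + w') i s = zvec w i s + zvec w' i s := rfl
    have h2 : lam (w + w') i s = lam w i s + lam w' i s := rfl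
    rw [h1, h2, gain_add_right]
    ring
  · simp only [objective, Finset.mul_sum]
    refine Finset.sum_congr rfl fun i _ => Finset.sum_congr rfl fun s _ => ?_
    have h1 : zvec (c • w) i s = c • zvec w i s := rfl
    have h2 : lam (c • w) i s = c * lam w i s := rfl
    rw [h1, h2, gain_smul_right]
    ring

/-- The point of `𝒴` with multipliers `l` and deviations `y`. -/
def mixture (l : G.Trigger → ℝ) (y : ∀ t : G.Trigger, G.Seq t.1 → ℝ) : G.YIdx → ℝ
  | Sum.inl t => l t
  | Sum.inr p => l ⟨p.1, p.2.1⟩ * y ⟨p.1, p.2.1⟩ p.2.2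

theorem mem_Y_iff {w : G.YIdx → ℝ} :
    w ∈ G.Y ↔ ∃ l ∈ stdSimplex ℝ G.Trigger, ∃ y : ∀ t : G.Trigger, G.Seq t.1 → ℝ,
      (∀ t, y t ∈ G.SeqForm t.2) ∧ w = mixture l y := by
  constructor
  · rintro ⟨h1, h2, h3⟩
    choose y hy hyz using fun t : G.Trigger => Set.mem_smul_set.1 (h3 t.1 t.2)
    refine ⟨fun t => lam w t.1 t.2, ⟨fun t => (h1 t.1 t.2).1, ?_⟩, y, hy, ?_⟩
    · rw [Fintype.sum_sigma]
      exact h2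
    · ext p
      rcases p with t | ⟨i, s, τ⟩
      · rfl
      · exact (congrFun (hyz ⟨i, s⟩) τ).symm
  · rintro ⟨l, hl, y, hy, rfl⟩
    refine ⟨fun i s => ⟨hl.1 ⟨i, s⟩, ?_⟩, ?_, fun i s => Set.mem_smul_set.2 ⟨_, hy ⟨i, s⟩, rfl⟩⟩
    · rw [← hl.2]
      exact Finset.single_le_sum (f := l) (fun t _ => hl.1 t) (Finset.mem_univ _)
    · rw [← hl.2, Fintype.sum_sigma]
      rfl

/-- A point of `Y` is a lottery over triggers, and the objective its mean trigger value; hence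
maximizing over `Y` is no better than choosing a single trigger. -/
theorem objective_mixture (ξ : G.XIdx → ℝ) (l : G.Trigger → ℝ)
    (y : ∀ t : G.Trigger, G.Seq t.1 → ℝ) :
    objective ξ (mixture l y) = ∑ t, l t * triggerValue t.2 ξ (y t) := by
  rw [Fintype.sum_sigma]
  refine Finset.sum_congr rfl fun i _ => Finset.sum_congr rfl fun s _ => ?_
  have h1 : zvec (mixture l y) i s = l ⟨i, s⟩ • y ⟨i, s⟩ := rfl
  have h2 : lam (mixture l y) i s = l ⟨i, s⟩ := rfl
  rw [h1, h2, gain_smul_right, triggerValue]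
  ring

theorem PerfectRecall.exists_objective_eq (hG : G.PerfectRecall) (s : G.Seq i)
    {y : G.Seq i → ℝ} (hy : y ∈ G.SeqForm s) :
    ∃ w ∈ G.Y, ∀ ξ, objective ξ w = triggerValue s ξ y := by
  classical
  -- Fillers for the triggers of multiplier zero.
  choose y₀ hy₀ using fun t : G.Trigger => hG.nonempty_seqForm t.2
  refine ⟨mixture (Pi.single ⟨i, s⟩ 1) (Function.update y₀ ⟨i, s⟩ y),
    mem_Y_iff.2 ⟨_, single_mem_stdSimplex ℝ _, _, fun t => ?_, rfl⟩, fun ξ => ?_⟩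
  · by_cases h : t = ⟨i, s⟩
    · subst h
      rwa [Function.update_self]
    · rw [Function.update_of_ne h]
      exact hy₀ t
  · rw [objective_mixture, Finset.sum_eq_single ⟨i, s⟩]
    · simp
    · intro t _ ht
      simp [ht]
    · simp

/-- `Y` is the linear image of the distributions over pairs of a trigger and a plan leading to it:
the marginal gives the multipliers, the conditionals the deviations. -/
theorem PerfectRecall.isPolytope_Y (hG : G.PerfectRecall) : IsPolytope G.Y := by
  let F : ((Σ t : G.Trigger, G.PlanTo t.2.1) → ℝ) →ₗ[ℝ] (G.YIdx → ℝ) :=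
    { toFun := fun μ p => match p with
        | Sum.inl t => ∑ ρ, μ ⟨t, ρ⟩
        | Sum.inr ⟨i, s, τ⟩ => seqOf (fun ρ : G.PlanTo s.1 => μ ⟨⟨i, s⟩, ρ⟩) τ
      map_add' := fun μ μ' => by
        ext p
        rcases p with t | ⟨i, s, τ⟩
        · simp [Finset.sum_add_distrib]
        · simp [seqOf_eq_sum_ind, add_mul, Finset.sum_add_distrib]
      map_smul' := fun c μ => by
        ext p
        rcases p with t | ⟨i, s, τ⟩
        · simp [Finset.mul_sum]
        · simp [seqOf_eq_sum_ind, mul_assoc, Finset.mul_sum] }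
  have hF : ∀ (l : G.Trigger → ℝ) (ν : ∀ t : G.Trigger, G.PlanTo t.2.1 → ℝ),
      (∀ t, ∑ ρ, ν t ρ = 1) →
      F (fun p => l p.1 * ν p.1 p.2) = mixture l fun t => seqOf (ν t) := by
    intro l ν hν
    ext p
    rcases p with t | ⟨i, s, τ⟩
    · simp [F, mixture, ← Finset.mul_sum, hν]
    · simp [F, mixture, seqOf_eq_sum_ind, Finset.mul_sum, mul_assoc]
  have : G.Y = F '' stdSimplex ℝ (Σ t : G.Trigger, G.PlanTo t.2.1) := by
    ext w
    constructor
    · intro hw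
      obtain ⟨l, hl, y, hy, rfl⟩ := mem_Y_iff.1 hw
      choose ν hν hνy using fun t : G.Trigger => hG.exists_seqOf_eq t.2 (hy t)
      refine ⟨fun p => l p.1 * ν p.1 p.2, ⟨fun p => mul_nonneg (hl.1 _) ((hν _).1 _), ?_⟩, ?_⟩
      · rw [Fintype.sum_sigma, ← hl.2]
        exact Finset.sum_congr rfl fun t _ => by
          rw [show l t = l t * ∑ ρ, ν t ρ by rw [(hν t).2, mul_one], Finset.mul_sum]
      · rw [hF l ν fun t => (hν t).2]
        simp only [hνy]
    · rintro ⟨μ, hμ, rfl⟩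
      have hl0 : ∀ t : G.Trigger, 0 ≤ ∑ ρ, μ ⟨t, ρ⟩ := fun t =>
        Finset.sum_nonneg fun ρ _ => hμ.1 _
      -- Conditional distributions, arbitrary where the marginal vanishes.
      have hex : ∀ t : G.Trigger, ∃ ν ∈ stdSimplex ℝ (G.PlanTo t.2.1),
          ∀ ρ, μ ⟨t, ρ⟩ = (∑ ρ, μ ⟨t, ρ⟩) * ν ρ := by
        intro t
        by_cases h : ∑ ρ, μ ⟨t, ρ⟩ = 0
        · have := hG.nonempty_planTo t.2.1
          obtain ⟨ν, hν⟩ := nonempty_stdSimplex (κ := G.PlanTo t.2.1)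
          refine ⟨ν, hν, fun ρ => ?_⟩
          rw [h, zero_mul]
          exact (Finset.sum_eq_zero_iff_of_nonneg fun ρ _ => hμ.1 _).1 h ρ (Finset.mem_univ _)
        · refine ⟨fun ρ => μ ⟨t, ρ⟩ / ∑ ρ, μ ⟨t, ρ⟩,
            ⟨fun ρ => div_nonneg (hμ.1 _) (hl0 t), ?_⟩, fun ρ => (mul_div_cancel₀ _ h).symm⟩
          rw [← Finset.sum_div, div_self h]
      choose ν hν hμν using hex
      refine mem_Y_iff.2 ⟨fun t => ∑ ρ, μ ⟨t, ρ⟩, ⟨hl0, ?_⟩, fun t => seqOf (ν t),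
        fun t => hG.seqOf_mem_seqForm t.2 (hν t), ?_⟩
      · exact (Fintype.sum_sigma μ).symm.trans hμ.2
      · rw [← hF _ ν fun t => (hν t).2]
        exact congrArg F (funext fun p => hμν p.1 p.2)
  rw [this]
  exact isPolytope_image_stdSimplex F

theorem continuous_triggerValue (s : G.Seq i) (ξ : G.XIdx → ℝ) :
    Continuous (triggerValue s ξ) := by
  obtain ⟨A, b, h⟩ := exists_matrix_gain_base s
  have : triggerValue s ξ =
      fun y => (fun x => ξ (⟨i, x.1⟩, x.2)) ⬝ᵥ (A *ᵥ y) - base s ξ := by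
    ext y
    rw [triggerValue, (h ξ y).1]
  rw [this]
  fun_prop

theorem PerfectRecall.isGreatest_vStar (hG : G.PerfectRecall) (hne : ∃ i, Nonempty (G.Info i))
    (ξ : G.XIdx → ℝ) : IsGreatest (deviationValues ξ) (vStar ξ) := by
  have heq : deviationValues ξ = ⋃ t : G.Trigger, triggerValue t.2 ξ '' G.SeqForm t.2 := by
    ext r
    simp only [Set.mem_iUnion, Set.mem_image]
    constructor
    · rintro ⟨i, s, y, hy, rfl⟩
      exact ⟨⟨i, s⟩, y, hy, rfl⟩
    · rintro ⟨t, y, hy, rfl⟩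
      exact ⟨t.1, t.2, y, hy, rfl⟩
  have hcomp : IsCompact (deviationValues ξ) := by
    rw [heq]
    exact isCompact_iUnion fun t =>
      (hG.isPolytope_seqForm t.2).isCompact.image (continuous_triggerValue t.2 ξ)
  refine hcomp.isGreatest_sSup ?_
  obtain ⟨i, ⟨I⟩⟩ := hne
  obtain ⟨y, hy⟩ := hG.nonempty_seqForm (⟨I, Classical.arbitrary _⟩ : G.Seq i)
  exact ⟨_, i, _, y, hy, rfl⟩

theorem PerfectRecall.isGreatest_objective (hG : G.PerfectRecall)
    (hne : ∃ i, Nonempty (G.Info i)) (ξ : G.XIdx → ℝ) :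
    IsGreatest (objective ξ '' G.Y) (vStar ξ) := by
  have hv := hG.isGreatest_vStar hne ξ
  constructor
  · obtain ⟨i, s, y, hy, e⟩ := hv.1
    obtain ⟨w, hw, hobj⟩ := hG.exists_objective_eq s hy
    exact ⟨w, hw, (hobj ξ).trans e.symm⟩
  · rintro _ ⟨w, hw, rfl⟩
    obtain ⟨l, hl, y, hy, rfl⟩ := mem_Y_iff.1 hw
    calc objective ξ (mixture l y) = ∑ t, l t * triggerValue t.2 ξ (y t) :=
          objective_mixture ξ l y
      _ ≤ ∑ t, l t * vStar ξ := Finset.sum_le_sum fun t _ =>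
          mul_le_mul_of_nonneg_left (hv.2 ⟨t.1, t.2, y t, hy t, rfl⟩) (hl.1 t)
      _ = vStar ξ := by rw [← Finset.sum_mul, hl.2, one_mul]

theorem PerfectRecall.isEFCE_iff_vStar_nonpos (hG : G.PerfectRecall)
    (hne : ∃ i, Nonempty (G.Info i)) (μ : G.Profile → ℝ) :
    IsEFCE μ ↔ vStar (corrPlan μ) ≤ 0 := by
  have hv := hG.isGreatest_vStar hne (corrPlan μ)
  rw [hG.isEFCE_iff_triggerUtil_le]
  constructor
  · intro h
    obtain ⟨i, s, y, hy, e⟩ := hv.1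
    obtain ⟨ν, hν, rfl⟩ := hG.exists_seqOf_eq s hy
    rw [e, hG.triggerValue_eq s μ hν]
    exact sub_nonpos.2 (h i s ν hν)
  · intro h i s ν hν
    rw [← sub_nonpos, ← hG.triggerValue_eq s μ hν]
    exact (hv.2 ⟨i, s, _, hG.seqOf_mem_seqForm s hν, rfl⟩).trans h

theorem PerfectRecall.isEFCEPlan_iff_vStar_nonpos (hG : G.PerfectRecall)
    (hne : ∃ i, Nonempty (G.Info i)) {ξ : G.XIdx → ℝ} (hξ : ξ ∈ G.X) :
    IsEFCEPlan ξ ↔ vStar ξ ≤ 0 := by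
  constructor
  · rintro ⟨μ, -, rfl, h⟩
    exact (hG.isEFCE_iff_vStar_nonpos hne μ).1 h
  · obtain ⟨μ, hμ, rfl⟩ := hξ
    exact fun h => ⟨μ, hμ, rfl, (hG.isEFCE_iff_vStar_nonpos hne μ).2 h⟩

/-- Some mixed deviation gains nothing and loses nothing against any correlation plan. -/
theorem PerfectRecall.exists_objective_eq_zero (hG : G.PerfectRecall)
    (hne : ∃ i, Nonempty (G.Info i)) : ∃ w ∈ G.Y, ∀ ξ ∈ G.X, objective ξ w = 0 := by
  obtain ⟨i, hi⟩ := hne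
  obtain ⟨s, ν, hν, h⟩ := hG.exists_neutral_trigger (i := i)
  obtain ⟨w, hw, hobj⟩ := hG.exists_objective_eq s (hG.seqOf_mem_seqForm s hν)
  refine ⟨w, hw, ?_⟩
  rintro _ ⟨μ, -, rfl⟩
  rw [hobj, hG.triggerValue_eq s μ hν, h μ, sub_self]

theorem PerfectRecall.isLeast_vStar (hG : G.PerfectRecall) (hne : ∃ i, Nonempty (G.Info i)) :
    IsLeast (vStar '' G.X) 0 := by
  obtain ⟨w, hw, h0⟩ := hG.exists_objective_eq_zero hne
  have hnonneg : ∀ ξ ∈ G.X, 0 ≤ vStar ξ := fun ξ hξ =>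
    (h0 ξ hξ).symm.le.trans ((hG.isGreatest_objective hne ξ).2 ⟨w, hw, rfl⟩)
  constructor
  · obtain ⟨μ, hμ, h⟩ := hG.exists_isEFCE
    have hξ : corrPlan μ ∈ G.X := ⟨μ, hμ, rfl⟩
    exact ⟨_, hξ, le_antisymm ((hG.isEFCE_iff_vStar_nonpos hne μ).1 h) (hnonneg _ hξ)⟩
  · rintro _ ⟨ξ, hξ, rfl⟩
    exact hnonneg ξ hξ

theorem PerfectRecall.isEFCEPlan_iff_isMinOn (hG : G.PerfectRecall)
    (hne : ∃ i, Nonempty (G.Info i)) {ξ : G.XIdx → ℝ} (hξ : ξ ∈ G.X) :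
    IsEFCEPlan ξ ↔ IsMinOn vStar G.X ξ := by
  rw [hG.isEFCEPlan_iff_vStar_nonpos hne hξ, isMinOn_iff]
  obtain ⟨⟨ξ₀, hξ₀, h0⟩, hle⟩ := hG.isLeast_vStar hne
  exact ⟨fun h ξ' hξ' => h.trans (hle ⟨ξ', hξ', rfl⟩), fun h => (h ξ₀ hξ₀).trans h0.le⟩

/-- The neutral `w` serves every EFCE, as its objective is constantly 0 on `X` while all values at
an EFCE are at most 0. Conversely, the first component of a saddle point minimizes `vStar`. -/
theorem PerfectRecall.isEFCEPlan_iff_exists_isSaddlePointOn (hG : G.PerfectRecall)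
    (hne : ∃ i, Nonempty (G.Info i)) {ξ : G.XIdx → ℝ} (hξ : ξ ∈ G.X) :
    IsEFCEPlan ξ ↔ ∃ w ∈ G.Y, IsSaddlePointOn G.X G.Y objective ξ w := by
  constructor
  · intro h
    obtain ⟨w, hw, h0⟩ := hG.exists_objective_eq_zero hne
    refine ⟨w, hw, fun ξ' hξ' w' hw' => ?_⟩
    rw [h0 ξ' hξ']
    exact ((hG.isGreatest_objective hne ξ).2 ⟨w', hw', rfl⟩).trans
      ((hG.isEFCEPlan_iff_vStar_nonpos hne hξ).1 h)
  · rintro ⟨w, hw, h⟩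
    refine (hG.isEFCEPlan_iff_isMinOn hne hξ).2 (isMinOn_iff.2 fun ξ' hξ' => ?_)
    obtain ⟨w', hw', e⟩ := (hG.isGreatest_objective hne ξ).1
    rw [← e]
    exact (h ξ' hξ' w' hw').trans ((hG.isGreatest_objective hne ξ').2 ⟨w, hw, rfl⟩)

end Game

theorem mainTheorem1 (G : Game.{u, v}) (hG : G.PerfectRecall) (hne : ∃ i, Nonempty (G.Info i)) :
    -- `𝒳`, `𝒴` and the sets of sequence-form deviations are polytopes, and the dimensions of the
    -- ambient spaces of `𝒳` and `𝒴` are at most quadratic in the size of the game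
    IsPolytope G.X ∧ IsPolytope G.Y ∧
    Fintype.card G.XIdx ≤ G.size ^ 2 ∧ Fintype.card G.YIdx ≤ G.size ^ 2 ∧
    (∀ (i : Fin 2) (s : G.Seq i), IsPolytope (G.SeqForm s) ∧
      G.SeqForm s = Game.seqOf '' stdSimplex ℝ (G.PlanTo s.1)) ∧
    -- the trigger value is the gain in expected utility of the trigger agent over a player who
    -- follows all recommendations, and it is biaffine
    (∀ (i : Fin 2) (s : G.Seq i), ∀ μ ∈ G.CorrDist, ∀ ν ∈ stdSimplex ℝ (G.PlanTo s.1),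
      Game.triggerValue s (Game.corrPlan μ) (Game.seqOf ν) =
        Game.triggerUtil i s μ ν - Game.followUtil i μ) ∧
    (∀ (i : Fin 2) (s : G.Seq i), ∃ (A : Matrix (G.Seq i × G.Z) (G.Seq i) ℝ)
      (b : G.Seq i × G.Z → ℝ), ∀ (ξ : G.XIdx → ℝ) (y : G.Seq i → ℝ),
        Game.gain s ξ y = (fun x => ξ (⟨i, x.1⟩, x.2)) ⬝ᵥ (A *ᵥ y) ∧
        Game.base s ξ = b ⬝ᵥ (fun x => ξ (⟨i, x.1⟩, x.2))) ∧
    -- `v*` is a maximum, both over all deviations and over `𝒴`, where the objective is bilinear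
    (∀ ξ : G.XIdx → ℝ, IsGreatest (Game.deviationValues ξ) (Game.vStar ξ) ∧
      IsGreatest (Game.objective ξ '' G.Y) (Game.vStar ξ)) ∧
    (∃ M : Matrix G.XIdx G.YIdx ℝ, ∀ ξ w, Game.objective ξ w = ξ ⬝ᵥ (M *ᵥ w)) ∧
    -- EFCEs are characterized by trigger agents and by `v* ≤ 0`
    (∀ μ ∈ G.CorrDist,
      (Game.IsEFCE μ ↔ ∀ (i : Fin 2) (s : G.Seq i), ∀ ν ∈ stdSimplex ℝ (G.PlanTo s.1),
        Game.triggerUtil i s μ ν ≤ Game.followUtil i μ) ∧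
      (Game.IsEFCE μ ↔ Game.vStar (Game.corrPlan μ) ≤ 0)) ∧
    (∀ ξ ∈ G.X, Game.IsEFCEPlan ξ ↔ Game.vStar ξ ≤ 0) ∧
    -- EFCEs exist, the optimal value is `0`, and the EFCEs are the solutions of the problem
    (∃ μ ∈ G.CorrDist, Game.IsEFCE μ) ∧
    IsLeast (Game.vStar '' G.X) 0 ∧
    (∀ ξ ∈ G.X, Game.IsEFCEPlan ξ ↔ IsMinOn Game.vStar G.X ξ) ∧
    (∀ ξ ∈ G.X, Game.IsEFCEPlan ξ ↔
      ∃ w ∈ G.Y, IsSaddlePointOn G.X G.Y Game.objective ξ w) := by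
  exact ⟨G.isPolytope_X, hG.isPolytope_Y, G.card_xIdx_le, G.card_yIdx_le,
    fun i s => ⟨hG.isPolytope_seqForm s, hG.seqForm_eq_image s⟩,
    fun i s μ _ ν hν => hG.triggerValue_eq s μ hν,
    fun i s => Game.exists_matrix_gain_base s,
    fun ξ => ⟨hG.isGreatest_vStar hne ξ, hG.isGreatest_objective hne ξ⟩,
    G.exists_matrix_objective,
    fun μ _ => ⟨hG.isEFCE_iff_triggerUtil_le μ, hG.isEFCE_iff_vStar_nonpos hne μ⟩,
    fun ξ hξ => hG.isEFCEPlan_iff_vStar_nonpos hne hξ,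
    hG.exists_isEFCE, hG.isLeast_vStar hne,
    fun ξ hξ => hG.isEFCEPlan_iff_isMinOn hne hξ,
    fun ξ hξ => hG.isEFCEPlan_iff_exists_isSaddlePointOn hne hξ⟩
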